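/- **Setting.** There are $n\ge 1$ service requests located at nodes of a metric graph $G$; request $p$ may be serviced during its window $[w_p,w_p+\ell_p)$, where $1\le \ell_p\le 2$. A *service run at speed $s$* visits distinct requests, each inside its window, starting at any request at any time, with at least $d(x,y)/s$ time between consecutive services at locations $x,y$. Its *profit* is the number of requests serviced. For $\alpha>0$ and $\tau\in\mathbb R$, the set of periods of length $\alpha$ with starting point $\tau$ is $\{[\tau+i\alpha,\tau+(i+1)\alpha): i\in\mathbb Z\}$; no window is regarded as starting on a period boundary (one that does is treated as starting just after it). $W_\ell$ denotes the windows that completely fill exactly $\ell$ periods. Let $m$ be the number of combinatorially different sets of periods of length $1/2$, i.e. the number of distinct values of $w_p$ modulo $1/2$. **Path subroutine.** Let $F$ be a procedure that, for any list $P$ of requests at nodes of $G$, produces a table which for all $u,v\in P$ and all $k$ gives either nothing or a path from $u$ to $v$ through distinct requests of $P$. It is required that, whenever some path from $u$ to $v$ visits exactly $k$ requests of $P$, the table entry for $(u,v,k)$ is a path visiting at least $k/\gamma$ requests that is no longer than any such path. Let $F$ take at most $\Gamma(|P|)$ steps for every nonempty $P$, where $\Gamma:\mathbb N\to\mathbb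 N$ satisfies $\Gamma(a)+\Gamma(b)\le\Gamma(a+b)$ and $\Gamma(n)\ge n^4$. **Algorithm SPEEDUPW12** (speed $s$). For a set of periods and $j\in\{1,2\}$, $k\in\{1,2,3\}$, trim each window in $W_1$ to its first, each in $W_2$ to its $j$-th and each in $W_3$ to its $k$-th completely filled period, discarding the other windows. The *repairman algorithm* for trimmed windows calls $F$ on the requests trimmed to each period and pastes the paths found together, period by period, by a dynamic program that keeps, for each last request and each total profit, a partial run at speed $s$ that ends earliest. The subroutine SPEEDUP$(\alpha,\tau_0,j,k)$ does this for periods of length $\alpha$ with starting points $\tau_0+i\alpha/r$, $0\le i<r$, where $s=q/r$; if $r$ exceeds the number of different values of $w_p$ modulo $\alpha$, or if no denominator $r$ is given, it uses the starting points congruent to these values modulo $\alpha$ instead. It retains the best run. SPEEDUPW12 returns the best run found by SPEEDUP$(\tfrac12,\tfrac i4,j,k)$ for $i<2$, $j\le2$, $k\le 3$; SPEEDUP$(\tfrac34,\tfrac i4,j,1)$ for $i<3$, $j\le 2$; and SPEEDUP$(1,\tfrac i4,1,1)$ for $i<4$. **Theorem.** There is an absolute constant $C$ such that the following holds for all $G,F,\gamma,\Gamma$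 as above and every instance with $n\ge1$ requests all of whose windows lie in $W_3$ for periods of length $1/2$ with some starting point. For every real $s$ with $4\le s\le 6$, SPEEDUPW12 finds a service run $\hat R$ at speed $s$ such that $$\mathrm{profit}(R^*)\le \frac{4\gamma}{s-2}\,\mathrm{profit}(\hat R)$$ for every service run $R^*$ at unit speed; that is, it finds a $4\gamma/(s-2)$-approximation. On a unit-cost real RAM (with floor) it takes at most $C\min\{r,m\}\,\Gamma(n)$ steps if it is given a representation $s=q/r$ with integers $q$ and $r\ge1$, and at most $C\,m\,\Gamma(n)$ steps if no such representation is given. -/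

import Mathlib

/-! ## Step-counted computations

Running times are counted on a unit-cost real RAM: one step pays for a bounded number of
elementary operations (arithmetic, comparison and floor of real numbers, a table read or write,
adding an element to a linked list).  A computation carries the number of steps it has made. -/

/-- The result of a computation together with the number of steps it took. -/
structure Timed (α : Type) where
  val : α
  steps : ℕ

namespace Timed

instance : Monad Timed where
  pure a := ⟨a, 0⟩
  bind x f := ⟨(f x.val).val, x.steps + (f x.val).steps⟩

/-- A value obtained by a bounded number of elementary operations. -/
def step {α : Type} (a : α) : Timed α := ⟨a, 1⟩

/-- A loop over the list `l` with state `b`; each iteration costs one step plus the cost of its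
body. -/
def loop {α β : Type} (f : β → α → Timed β) : β → List α → Timed β
  | b, [] => step b
  | b, a :: l => do
      let b ← step b
      let b' ← f b a
      loop f b' l

/-- A new array of length `n` whose entries are computed by an elementary expression each. -/
def tabulate {β : Type} {n : ℕ} (f : Fin n → β) : Timed (Fin n → β) := ⟨f, n + 1⟩

/-- Apply an elementary expression to each entry of a list. -/
def mapList {α β : Type} (f : α → β) : List α → Timed (List β)
  | [] => step []
  | a :: l => do
      let b ← step (f a)
      let l' ← mapList f l
      pure (b :: l')

/-- Insert `x` into a strictly increasing list, unless it is already there. -/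
def insertSorted {α : Type} [LinearOrder α] (x : α) : List α → Timed (List α)
  | [] => step [x]
  | y :: l => do
      let c ← step (cmp x y)
      match c with
      | .lt => pure (x :: y :: l)
      | .eq => pure (y :: l)
      | .gt => do
          let l' ← insertSorted x l
          pure (y :: l')

/-- The distinct entries of a list in increasing order (insertion sort). -/
def distinctSorted {α : Type} [LinearOrder α] (l : List α) : Timed (List α) :=
  loop (fun acc x => insertSorted x acc) [] l

end Timed

noncomputable section

/-! ## The unrooted traveling repairman problem -/

/-- `n` service requests at nodes of a metric graph `V`; request `p` may be serviced during its
time window `[start p, finish p)`. -/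
structure RepairInstance (V : Type*) (n : ℕ) where
  loc : Fin n → V
  start : Fin n → ℝ
  finish : Fin n → ℝ

/-- A service run of a repairman with speed `s`: the requests it services in the order of service,
each with its time of service.  No request is serviced twice, each one is serviced inside its
window, and there is enough time to travel from each one to the next.  The run starts at any
request at any time.  Its profit is the number of requests serviced, that is, its length. -/
def RepairInstance.IsServiceRun {V : Type*} [MetricSpace V] {n : ℕ} (I : RepairInstance V n)
    (s : ℝ) (R : List (Fin n × ℝ)) : Prop :=
  (R.map Prod.fst).Nodup ∧
  (∀ x ∈ R, I.start x.1 ≤ x.2 ∧ x.2 < I.finish x.1) ∧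
  R.IsChain (fun x y => dist (I.loc x.1) (I.loc y.1) ≤ s * (y.2 - x.2))

/-! ## Periods and windows

The set of periods of length `α` with starting point `τ` consists of the intervals
`[τ + i * α, τ + (i + 1) * α)` for integers `i`.  No window is regarded as starting at the
beginning of a period: a window that begins exactly at a division of time is treated as if it
began immediately after it. -/

/-- The indices of the periods that are completely filled by the window `[a, b)`. -/
def fullPeriods (α τ a b : ℝ) : Set ℤ :=
  {i : ℤ | a < τ + i * α ∧ τ + (i + 1) * α ≤ b}

/-- The window `[a, b)` belongs to the set `W_ℓ` for the given set of periods. -/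
def InW (ℓ : ℕ) (α τ a b : ℝ) : Prop := (fullPeriods α τ a b).ncard = ℓ

/-- The number of combinatorially different sets of periods of length `α` for the instance: as the
starting point of the periods varies, the first period filled by a window changes exactly when a
division passes the start of the window, so this is the number of different window starts
modulo `α`. -/
def RepairInstance.numPeriodSets {V : Type*} {n : ℕ} (I : RepairInstance V n) (α : ℝ) : ℕ :=
  (Finset.univ.image (fun p => Int.fract (I.start p / α))).card

/-- The index of the period to which the window `[a, b)` is trimmed: a window in `W_1` is trimmed
to its first, a window in `W_2` to its `j`-th and a window in `W_3` to its `k`-th completely filled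
period.  Other windows vanish. -/
def trimIndex (α τ : ℝ) (j k : ℕ) (a b : ℝ) : Option ℤ :=
  let first := ⌊(a - τ) / α⌋ + 1
  let count := ⌊(b - τ) / α⌋ - first
  if count = 1 then some first
  else if count = 2 then some (first + ((j : ℤ) - 1))
  else if count = 3 then some (first + ((k : ℤ) - 1))
  else none

/-! ## Maximum profit paths within a period -/

/-- The length of the path through the given requests. -/
def pathLength {V : Type*} [MetricSpace V] {n : ℕ} (loc : Fin n → V) : List (Fin n) → ℝ
  | [] => 0
  | [_] => 0
  | p :: q :: l => dist (loc p) (loc q) + pathLength loc (q :: l)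

/-- `l` is a path from `u` to `v` through different requests of `P`; its profit is `l.length`. -/
def IsPath {n : ℕ} (P : List (Fin n)) (u v : Fin n) (l : List (Fin n)) : Prop :=
  l.Nodup ∧ (∀ p ∈ l, p ∈ P) ∧ l.head? = some u ∧ l.getLast? = some v

/-- A procedure for finding paths of large profit on the metric graph `V`.  For a list `P` of
requests (those trimmed to one period) it produces a table that has, for any two requests `u` and
`v` of `P` and any number `k`, a path from `u` to `v`, or `[]`. -/
abbrev PathFinder (V : Type*) :=
  (n : ℕ) → (Fin n → V) → List (Fin n) → Timed (Fin n → Fin n → ℕ → List (Fin n))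

/-- The procedure is a `γ`-approximation: the entry for `u`, `v`, `k` is empty or a path from `u` to
`v`, and whenever `k` requests of `P` can be visited on a path from `u` to `v`, it is a path with
profit at least `k / γ` that is no longer than any path from `u` to `v` with profit `k`. -/
def PathFinder.IsApprox {V : Type*} [MetricSpace V] (F : PathFinder V) (γ : ℝ) : Prop :=
  ∀ (n : ℕ) (loc : Fin n → V) (P : List (Fin n)), P.Nodup → ∀ u ∈ P, ∀ v ∈ P,
    (∀ k, (F n loc P).val u v k = [] ∨ IsPath P u v ((F n loc P).val u v k)) ∧
    ∀ Q, IsPath P u v Q →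
      IsPath P u v ((F n loc P).val u v Q.length) ∧
      pathLength loc ((F n loc P).val u v Q.length) ≤ pathLength loc Q ∧
      (Q.length : ℝ) ≤ γ * ((F n loc P).val u v Q.length).length

/-- The procedure takes at most `Γ n'` steps on `n'` requests. -/
def PathFinder.RunsIn {V : Type*} (F : PathFinder V) (Γ : ℕ → ℕ) : Prop :=
  ∀ (n : ℕ) (loc : Fin n → V) (P : List (Fin n)), P ≠ [] → P.Nodup →
    (F n loc P).steps ≤ Γ P.length

/-! ## The repairman algorithm for trimmed windows -/

/-- A partial run found by the dynamic program: the time at which it ends, and its paths within the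
periods, the latest one first, each with the time at which it begins. -/
structure PartialRun (n : ℕ) where
  time : ℝ
  parts : List (ℝ × List (Fin n))

/-- For each last request and each profit, the partial run with the earliest end found so far. -/
abbrev RunTable (n : ℕ) := Fin n → ℕ → Option (PartialRun n)

/-- An empty table for profits `0, …, n`. -/
def newTable (n : ℕ) : Timed (RunTable n) := ⟨fun _ _ => none, n * (n + 1)⟩

/-- Put the partial run `x` into the table, unless there is one that ends no later. -/
def relax {n : ℕ} (T : RunTable n) (v : Fin n) (π : ℕ) (x : PartialRun n) : Timed (RunTable n) :=
  Timed.step <|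
    match T v π with
    | none => Function.update T v (Function.update (T v) π (some x))
    | some y =>
        if x.time < y.time then Function.update T v (Function.update (T v) π (some x)) else T

/-- Length and profit of a path, by traversing it. -/
def measurePath {V : Type*} [MetricSpace V] {n : ℕ} (loc : Fin n → V) :
    List (Fin n) → Timed (ℝ × ℕ)
  | [] => Timed.step (0, 0)
  | [_] => Timed.step (0, 1)
  | p :: q :: l => do
      let x ← measurePath loc (q :: l)
      Timed.step (dist (loc p) (loc q) + x.1, x.2 + 1)

/-- For the requests `P` of a period that begins at time `a`: for each request `u` of `P` and each
profit, the partial run from the earlier periods with which `u` is reached earliest, together with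
the time, not before `a`, at which it reaches `u`. -/
def entryTable {V : Type*} [MetricSpace V] {n : ℕ} (loc : Fin n → V) (s a : ℝ)
    (P : List (Fin n)) (T : RunTable n) : Timed (RunTable n) := do
  let E ← newTable n
  Timed.loop (fun E u => do
    let E ← relax E u 0 ⟨a, []⟩
    Timed.loop (fun E w =>
      Timed.loop (fun E π =>
        match T w π with
        | none => Timed.step E
        | some x => relax E u π ⟨max a (x.time + dist (loc w) (loc u) / s), x.parts⟩)
        E (List.range (n + 1)))
      E (List.finRange n)) E P

/-- Extend the runs by the paths within the period, which ends at time `b`. -/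
def extendTable {V : Type*} [MetricSpace V] {n : ℕ} (loc : Fin n → V) (s b : ℝ)
    (P : List (Fin n)) (paths : Fin n → Fin n → ℕ → List (Fin n)) (E T : RunTable n) :
    Timed (RunTable n) :=
  Timed.loop (fun T u =>
    Timed.loop (fun T v =>
      Timed.loop (fun T k =>
        match paths u v (k + 1) with
        | [] => Timed.step T
        | p :: l => do
            let x ← measurePath loc (p :: l)
            Timed.loop (fun T π =>
              match E u π with
              | none => Timed.step T
              | some y =>
                  if y.time + x.1 / s < b then
                    relax T v (π + x.2) ⟨y.time + x.1 / s, (y.time, p :: l) :: y.parts⟩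
                  else Timed.step T)
              T (List.range (n + 1)))
        T (List.range P.length)) T P) T P

/-- The stops of a path that is traversed at speed `s`, beginning at time `t`, put in front of the
stops `rest`. -/
def emitPath {V : Type*} [MetricSpace V] {n : ℕ} (loc : Fin n → V) (s : ℝ)
    (rest : List (Fin n × ℝ)) : ℝ → List (Fin n) → Timed (List (Fin n × ℝ))
  | _, [] => Timed.step rest
  | t, [p] => Timed.step ((p, t) :: rest)
  | t, p :: q :: l => do
      let R ← emitPath loc s rest (t + dist (loc p) (loc q) / s) (q :: l)
      Timed.step ((p, t) :: R)

/-- The partial run of greatest profit in the table, with its profit. -/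
def bestEntry {n : ℕ} (T : RunTable n) : Timed (ℕ × List (ℝ × List (Fin n))) :=
  Timed.loop (fun best v =>
    Timed.loop (fun best π =>
      match T v π with
      | none => Timed.step best
      | some x => Timed.step (if best.1 < π then (π, x.parts) else best))
      best (List.range (n + 1))) (0, []) (List.finRange n)

/-- The repairman algorithm for trimmed windows: request `p` has to be serviced in the period with
index `per p`, at speed `s`.  Dynamic programming over the periods pastes together the paths found
by `F` within the periods. The result is a run with its profit. -/
def repairman {V : Type*} [MetricSpace V] (F : PathFinder V) {n : ℕ} (loc : Fin n → V)
    (s α τ : ℝ) (per : Fin n → Option ℤ) : Timed (ℕ × List (Fin n × ℝ)) := do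
  let periods ← Timed.loop (fun acc p =>
    match per p with
    | none => Timed.step acc
    | some i => Timed.insertSorted i acc) [] (List.finRange n)
  let T ← newTable n
  let T ← Timed.loop (fun T i => do
    let P ← Timed.loop (fun acc p =>
      Timed.step (if per p = some i then p :: acc else acc)) [] (List.finRange n)
    let paths ← F n loc P
    let E ← entryTable loc s (τ + i * α) P T
    extendTable loc s (τ + (i + 1) * α) P paths E T) T periods
  let best ← bestEntry T
  let R ← Timed.loop (fun R x => emitPath loc s R x.1 x.2) [] best.2
  pure (best.1, R)

/-! ## The algorithm for windows with lengths between 1 and 2 -/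

/-- Keep the more profitable of two runs. -/
def better {β : Type} (x y : ℕ × β) : Timed (ℕ × β) :=
  Timed.step (if x.1 < y.1 then y else x)

/-- The subroutine SPEEDUP.  Starting from the set of periods of length `α` with starting point
`τ₀`, the periods are moved forward, the windows are trimmed, the repairman algorithm is run at
speed `s`, and the best result is retained.  If the speed is a fraction with denominator `r`, the
periods are moved by the multiples of `α / r`; if `r` exceeds the number of combinatorially
different sets of periods, or if no denominator is available (`r = ⊤`), then one representative of
each of these is used instead. -/
def speedup {V : Type*} [MetricSpace V] (F : PathFinder V) {n : ℕ} (I : RepairInstance V n)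
    (s : ℝ) (r : ℕ∞) (α τ₀ : ℝ) (j k : ℕ) : Timed (ℕ × List (Fin n × ℝ)) := do
  let residues ← Timed.mapList (fun p => Int.fract ((I.start p - τ₀) / α) * α) (List.finRange n)
  let critical ← Timed.distinctSorted residues
  let m ← Timed.loop (fun m _ => Timed.step (m + 1)) 0 critical
  let offsets ←
    if r ≤ (m : ℕ∞) then
      Timed.mapList (fun i : ℕ => (i : ℝ) * α / (r.toNat : ℝ)) (List.range r.toNat)
    else Timed.step critical
  Timed.loop (fun best δ => do
    let per ← Timed.tabulate (fun p => trimIndex α (τ₀ + δ) j k (I.start p) (I.finish p))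
    let R ← repairman F I.loc s α (τ₀ + δ) per
    better best R) (0, []) offsets

/-- The trials `(α, τ₀, j, k)` of SPEEDUPW12, in three phases with periods of length `1/2`, `3/4`
and `1`. -/
def trials : List (ℝ × ℝ × ℕ × ℕ) :=
  ((List.range 2).flatMap fun i => [1, 2].flatMap fun j => [1, 2, 3].map fun k =>
    ((1 / 2 : ℝ), (i : ℝ) / 4, j, k)) ++
  ((List.range 3).flatMap fun i => [1, 2].map fun j => ((3 / 4 : ℝ), (i : ℝ) / 4, j, 1)) ++
  (List.range 4).map fun i => ((1 : ℝ), (i : ℝ) / 4, 1, 1)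

/-- The algorithm SPEEDUPW12: run SPEEDUP in each trial and retain the best run. -/
def speedupW12 {V : Type*} [MetricSpace V] (F : PathFinder V) {n : ℕ} (I : RepairInstance V n)
    (s : ℝ) (r : ℕ∞) : Timed (List (Fin n × ℝ)) := do
  let best ← Timed.loop (fun best c => do
    let R ← speedup F I s r c.1 c.2.1 c.2.2.1 c.2.2.2
    better best R) (0, []) trials
  pure best.2

end

/-! ## Values and costs of step-counted computations -/

namespace Timed

variable {α β : Type}

/-! The ratio comes from comparing the output with a fast repairman who imitates an arbitrary
unit-speed run `R`. He races back and forth along `R`: in each period of length `α` he first moves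
forward by `α`, taking time `α / s`, and then sweeps a stretch of `R` of length `(s - 1) * α`,
forward in even and backward in odd periods. In the period beginning at `c` he thus meets the stops
of `R` with times between `c - x` and `c - x + (s - 1) * α`, where `x` may be chosen freely. A stop
is gained when its request is trimmed to a period whose stretch contains its time
(`isSchedule_raceSchedule`, `countP_raced_le_repairman`).

The dynamic program loses only the factor `γ` against such a fast run. This is an exchange argument:
within a period, the portion of the fast run is replaced by a path of `F` with the same endpoints
that is no longer, so every later stop is still reached in time (`periodStep_dominates`).

The ratio needs only the trials with `α = 3 / 4`, with `x = 3 / 4 + ε` for a small `ε`. Windows `[a,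
b)` in `W_3` for half-unit periods satisfy `3 / 2 < b - a`, so they fill one or two periods of
length `3 / 4`, the first of which begins at some `f` in `(a, a + 3 / 4]`. If `14 / 3 ≤ s`, the
stretch of that first period contains the whole window. One trial then captures all of `R` up to
`γ`, which suffices because `4 / (s - 2) ≥ 1`. If only `4 ≤ s`, the stretch still reaches `f + 3 / 2
- ε`. Windows with `b < f + 3 / 2` fill a single period and are covered for both `j = 1` and `j =
2`; for the others, each time in the window is covered for at least one `j`. The three starting
points are spaced by `1 / 4`, so for one of them `f > a + 1 / 2`, whence `b < f + 3 / 2`. Each stop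
is therefore covered in at least `2 + 1 + 1 = 4` of the six trials, and averaging gives `4 |R| ≤ 6 γ
* profit`. This suffices for `s ≤ 14 / 3`, where `4 / (s - 2) ≥ 3 / 2`.

For the cost, one run of the dynamic program takes `O(Γ n)` steps by superadditivity of `Γ` and `n ^
4 ≤ Γ n`. Each of the 22 trials uses at most `6 * min r m` sets of periods, because `3` is a common
multiple of `1 / 2`, `3 / 4` and `1`. -/

@[simp] theorem val_pure (a : α) : (pure a : Timed α).val = a := rfl

@[simp] theorem steps_pure (a : α) : (pure a : Timed α).steps = 0 := rfl

@[simp] theorem val_bind (x : Timed α) (f : α → Timed β) : (x >>= f).val = (f x.val).val := rfl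

@[simp] theorem steps_bind (x : Timed α) (f : α → Timed β) :
    (x >>= f).steps = x.steps + (f x.val).steps := rfl

@[simp] theorem val_step (a : α) : (step a).val = a := rfl

@[simp] theorem steps_step (a : α) : (step a).steps = 1 := rfl

@[simp] theorem val_tabulate {n : ℕ} (f : Fin n → β) : (tabulate f).val = f := rfl

@[simp] theorem steps_tabulate {n : ℕ} (f : Fin n → β) : (tabulate f).steps = n + 1 := rfl

@[simp] theorem loop_nil (f : β → α → Timed β) (b : β) : loop f b [] = step b := rfl

@[simp] theorem val_loop_cons (f : β → α → Timed β) (b : β) (a : α) (l : List α) :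
    (loop f b (a :: l)).val = (loop f (f b a).val l).val := rfl

@[simp] theorem steps_loop_cons (f : β → α → Timed β) (b : β) (a : α) (l : List α) :
    (loop f b (a :: l)).steps = 1 + ((f b a).steps + (loop f (f b a).val l).steps) := rfl

/-- An invariant of the body is an invariant of the loop. -/
theorem loop_invariant {f : β → α → Timed β} {p : β → Prop} {l : List α} {b : β} (hb : p b)
    (h : ∀ b, ∀ a ∈ l, p b → p (f b a).val) : p (loop f b l).val := by
  induction l generalizing b with
  | nil => exact hb
  | cons a l ih =>
    rw [val_loop_cons]
    exact ih (h b a (by simp) hb) fun b a' ha' => h b a' (by simp [ha'])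

/-- A property that one iteration establishes under an invariant, and that the others preserve,
holds at the end of the loop. -/
theorem loop_establishes {f : β → α → Timed β} {p q : β → Prop} {l : List α} {b : β} {a : α}
    (ha : a ∈ l) (hb : p b) (hp : ∀ b, ∀ a ∈ l, p b → p (f b a).val)
    (hpq : ∀ b, p b → q (f b a).val) (hq : ∀ b, ∀ a ∈ l, q b → q (f b a).val) :
    q (loop f b l).val := by
  induction l generalizing b with
  | nil => simp at ha
  | cons c l ih =>
    rw [val_loop_cons]
    rcases List.mem_cons.1 ha with rfl | ha'
    · exact loop_invariant (hpq b hb) fun b a' h' => hq b a' (by simp [h'])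
    · exact ih ha' (hp b c (by simp) hb) (fun b a' h' => hp b a' (by simp [h']))
        fun b a' h' => hq b a' (by simp [h'])

theorem loop_steps_le_sum {f : β → α → Timed β} {l : List α} {c : α → ℕ}
    (h : ∀ b, ∀ a ∈ l, (f b a).steps ≤ c a) (b : β) :
    (loop f b l).steps ≤ 1 + (l.map fun a => 1 + c a).sum := by
  induction l generalizing b with
  | nil => simp
  | cons a l ih =>
    have h1 := h b a (by simp)
    have h2 := ih (fun b a' h' => h b a' (by simp [h'])) (f b a).val
    simp only [steps_loop_cons, List.map_cons, List.sum_cons]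
    omega

theorem loop_steps_le {f : β → α → Timed β} {l : List α} {c : ℕ}
    (h : ∀ b, ∀ a ∈ l, (f b a).steps ≤ c) (b : β) :
    (loop f b l).steps ≤ 1 + l.length * (1 + c) := by
  simpa using loop_steps_le_sum (c := fun _ => c) h b

/-- The cost of a loop whose state grows by at most one in each iteration, at a cost bounded by the
size of the state. -/
theorem loop_steps_le_of_size {f : β → α → Timed β} (size : β → ℕ)
    (hs : ∀ b a, size (f b a).val ≤ size b + 1) (hc : ∀ b a, (f b a).steps ≤ size b + 1)
    (b : β) (l : List α) :
    (loop f b l).steps ≤ 1 + l.length * (size b + l.length + 2) := by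
  induction l generalizing b with
  | nil => simp
  | cons a l ih =>
    have h1 := hc b a
    have h2 := ih (f b a).val
    have h3 : l.length * (size (f b a).val + l.length + 2) ≤
        l.length * (size b + 1 + l.length + 2) :=
      Nat.mul_le_mul_left _ (by have := hs b a; omega)
    simp only [steps_loop_cons, List.length_cons]
    nlinarith

@[simp] theorem val_mapList (f : α → β) (l : List α) : (mapList f l).val = l.map f := by
  induction l with
  | nil => rfl
  | cons a l ih =>
    change f a :: (mapList f l).val = _
    simp [ih]

@[simp] theorem steps_mapList (f : α → β) (l : List α) : (mapList f l).steps = l.length + 1 := by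
  induction l with
  | nil => rfl
  | cons a l ih =>
    change 1 + ((mapList f l).steps + 0) = _
    simp [ih]; omega

/-! ### Sorted insertion -/

section InsertSorted

variable [LinearOrder α]

theorem mem_insertSorted (x y : α) (l : List α) :
    y ∈ (insertSorted x l).val ↔ y = x ∨ y ∈ l := by
  induction l with
  | nil => simp [insertSorted]
  | cons z l ih =>
    rw [insertSorted]
    simp only [val_bind, val_step]
    rcases h : cmp x z with _ | _ | _
    · simp
    · simp [(cmp_eq_eq_iff _ _).1 h]
    · simp [ih, or_left_comm]

theorem pairwise_insertSorted (x : α) {l : List α} (hl : l.Pairwise (· < ·)) :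
    (insertSorted x l).val.Pairwise (· < ·) := by
  induction l with
  | nil => simp [insertSorted]
  | cons z l ih =>
    rw [insertSorted]
    simp only [val_bind, val_step]
    rw [List.pairwise_cons] at hl
    rcases h : cmp x z with _ | _ | _
    · have h' := (cmp_eq_lt_iff _ _).1 h
      simp only [val_pure, List.pairwise_cons, List.mem_cons, forall_eq_or_imp]
      exact ⟨⟨h', fun a ha => h'.trans (hl.1 a ha)⟩, hl⟩
    · simpa using hl
    · have h' := (cmp_eq_gt_iff _ _).1 h
      simp only [val_bind, val_pure, List.pairwise_cons, mem_insertSorted]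
      refine ⟨?_, ih hl.2⟩
      rintro a (rfl | ha)
      · exact h'
      · exact hl.1 a ha

theorem length_insertSorted_le (x : α) (l : List α) :
    (insertSorted x l).val.length ≤ l.length + 1 := by
  induction l with
  | nil => simp [insertSorted]
  | cons z l ih =>
    rw [insertSorted]
    simp only [val_bind, val_step]
    rcases h : cmp x z with _ | _ | _
    · simp
    · simp
    · simpa using ih

theorem steps_insertSorted_le (x : α) (l : List α) :
    (insertSorted x l).steps ≤ l.length + 1 := by
  induction l with
  | nil => simp [insertSorted]
  | cons z l ih =>
    rw [insertSorted]
    simp only [steps_bind, val_step, steps_step]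
    rcases h : cmp x z with _ | _ | _
    · simp
    · simp
    · simp only [steps_bind, steps_pure, List.length_cons]; omega

theorem mem_loop_insertSorted (l acc : List α) (y : α) :
    y ∈ (loop (fun acc x => insertSorted x acc) acc l).val ↔ y ∈ acc ∨ y ∈ l := by
  induction l generalizing acc with
  | nil => simp
  | cons a l ih => simp [ih, mem_insertSorted, or_assoc, or_left_comm]

theorem mem_distinctSorted (l : List α) (y : α) : y ∈ (distinctSorted l).val ↔ y ∈ l := by
  simp [distinctSorted, mem_loop_insertSorted]

theorem pairwise_distinctSorted (l : List α) : (distinctSorted l).val.Pairwise (· < ·) :=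
  loop_invariant (p := fun acc : List α => acc.Pairwise (· < ·)) List.Pairwise.nil
    fun _ x _ h => pairwise_insertSorted x h

theorem length_distinctSorted (l : List α) : (distinctSorted l).val.length = l.toFinset.card := by
  have h : (distinctSorted l).val.toFinset = l.toFinset := by
    ext y; simp [mem_distinctSorted]
  rw [← h, List.toFinset_card_of_nodup ((pairwise_distinctSorted l).imp ne_of_lt)]

theorem steps_distinctSorted_le (l : List α) :
    (distinctSorted l).steps ≤ 1 + l.length * (l.length + 2) := by
  simpa [distinctSorted] using loop_steps_le_of_size List.length
    (fun b a => length_insertSorted_le a b) (fun b a => steps_insertSorted_le a b) [] l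

end InsertSorted

end Timed

noncomputable section

/-! ## Paths and the stops they emit -/

section Paths

variable {V : Type*} [MetricSpace V] {n : ℕ}

/-- The stops of a path that is traversed at speed `s`, beginning at time `t`. -/
def pathStops (loc : Fin n → V) (s : ℝ) : ℝ → List (Fin n) → List (Fin n × ℝ)
  | _, [] => []
  | t, [p] => [(p, t)]
  | t, p :: q :: l => (p, t) :: pathStops loc s (t + dist (loc p) (loc q) / s) (q :: l)

theorem val_emitPath (loc : Fin n → V) (s : ℝ) (rest : List (Fin n × ℝ)) :
    ∀ (t : ℝ) (l : List (Fin n)), (emitPath loc s rest t l).val = pathStops loc s t l ++ rest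
  | _, [] => rfl
  | _, [_] => rfl
  | t, p :: q :: l => by
    simp [emitPath, pathStops, val_emitPath loc s rest _ (q :: l)]

theorem steps_emitPath (loc : Fin n → V) (s : ℝ) (rest : List (Fin n × ℝ)) :
    ∀ (t : ℝ) (l : List (Fin n)), l ≠ [] → (emitPath loc s rest t l).steps = l.length
  | _, [], h => absurd rfl h
  | _, [_], _ => rfl
  | t, p :: q :: l, _ => by
    simp [emitPath, steps_emitPath loc s rest _ (q :: l) (by simp)]

theorem pathLength_nonneg (loc : Fin n → V) : ∀ l : List (Fin n), 0 ≤ pathLength loc l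
  | [] => le_rfl
  | [_] => le_rfl
  | _ :: q :: l => add_nonneg dist_nonneg (pathLength_nonneg loc (q :: l))

theorem val_measurePath (loc : Fin n → V) :
    ∀ l : List (Fin n), (measurePath loc l).val = (pathLength loc l, l.length)
  | [] => rfl
  | [_] => rfl
  | p :: q :: l => by simp [measurePath, pathLength, val_measurePath loc (q :: l)]

theorem steps_measurePath (loc : Fin n → V) :
    ∀ l : List (Fin n), l ≠ [] → (measurePath loc l).steps = l.length
  | [], h => absurd rfl h
  | [_], _ => rfl
  | p :: q :: l, _ => by simp [measurePath, steps_measurePath loc (q :: l)]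

theorem map_fst_pathStops (loc : Fin n → V) (s : ℝ) :
    ∀ (t : ℝ) (l : List (Fin n)), (pathStops loc s t l).map Prod.fst = l
  | _, [] => rfl
  | _, [_] => rfl
  | t, p :: q :: l => by simp [pathStops, map_fst_pathStops loc s _ (q :: l)]

theorem length_pathStops (loc : Fin n → V) (s t : ℝ) (l : List (Fin n)) :
    (pathStops loc s t l).length = l.length := by
  rw [← List.length_map (f := Prod.fst), map_fst_pathStops]

theorem head?_pathStops (loc : Fin n → V) (s : ℝ) :
    ∀ (t : ℝ) (l : List (Fin n)), (pathStops loc s t l).head? = l.head?.map fun p => (p, t)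
  | _, [] => rfl
  | _, [_] => rfl
  | _, _ :: _ :: _ => rfl

theorem getLast?_pathStops (loc : Fin n → V) (s : ℝ) :
    ∀ (t : ℝ) (l : List (Fin n)), (pathStops loc s t l).getLast? =
      l.getLast?.map fun p => (p, t + pathLength loc l / s)
  | _, [] => rfl
  | _, [_] => by simp [pathStops, pathLength]
  | t, p :: q :: l => by
    have h := getLast?_pathStops loc s (t + dist (loc p) (loc q) / s) (q :: l)
    rw [pathStops, List.getLast?_cons, h, pathLength, add_div, ← add_assoc]
    rw [List.getLast?_cons_cons, List.getLast?_eq_some_getLast (by simp : q :: l ≠ [])]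
    simp

theorem mem_pathStops_time {loc : Fin n → V} {s : ℝ} (hs : 0 < s) :
    ∀ (t : ℝ) (l : List (Fin n)), ∀ z ∈ pathStops loc s t l,
      t ≤ z.2 ∧ z.2 ≤ t + pathLength loc l / s
  | _, [], z, hz => by simp [pathStops] at hz
  | _, [_], z, hz => by
    simp only [pathStops, List.mem_singleton] at hz
    simp [hz, pathLength]
  | t, p :: q :: l, z, hz => by
    have h0 : 0 ≤ dist (loc p) (loc q) / s := div_nonneg dist_nonneg hs.le
    have h1 : 0 ≤ pathLength loc (q :: l) / s := div_nonneg (pathLength_nonneg loc _) hs.le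
    rw [pathLength, add_div]
    rcases List.mem_cons.1 hz with rfl | hz
    · exact ⟨le_rfl, by simp only; linarith⟩
    · have := mem_pathStops_time hs _ (q :: l) z hz
      exact ⟨by linarith, by linarith⟩

theorem isChain_pathStops {loc : Fin n → V} {s : ℝ} (hs : 0 < s) :
    ∀ (t : ℝ) (l : List (Fin n)), (pathStops loc s t l).IsChain
      fun x y => dist (loc x.1) (loc y.1) ≤ s * (y.2 - x.2)
  | _, [] => List.IsChain.nil
  | _, [_] => List.IsChain.singleton _
  | t, p :: q :: l => by
    rw [pathStops, List.isChain_cons]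
    refine ⟨?_, isChain_pathStops hs _ (q :: l)⟩
    intro y hy
    rw [head?_pathStops] at hy
    simp only [List.head?_cons, Option.map_some, Option.mem_some] at hy
    subst hy
    simp [mul_div_cancel₀ _ hs.ne']

/-- The length of a path is bounded by the distance that a timed run through it allows. -/
theorem pathLength_le_of_isChain {loc : Fin n → V} {s : ℝ} :
    ∀ (S : List (Fin n × ℝ)), S.IsChain (fun x y => dist (loc x.1) (loc y.1) ≤ s * (y.2 - x.2)) →
      ∀ x ∈ S.head?, ∀ y ∈ S.getLast?, pathLength loc (S.map Prod.fst) ≤ s * (y.2 - x.2)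
  | [], _, x, hx => by simp at hx
  | [z], _, x, hx => by
    intro y hy
    simp only [List.head?_cons, Option.mem_some, List.getLast?_singleton] at hx hy
    subst hx; subst hy
    simp [pathLength]
  | z :: w :: S, h, x, hx => by
    intro y hy
    rw [List.isChain_cons_cons] at h
    rw [List.getLast?_cons_cons] at hy
    simp only [List.head?_cons, Option.mem_some] at hx
    subst hx
    have := pathLength_le_of_isChain (w :: S) h.2 w (by simp) y hy
    simp only [List.map_cons, pathLength] at this ⊢
    linarith [h.1]

/-- The run that consists of the given paths, the latest one first. -/
def partsRun (loc : Fin n → V) (s : ℝ) : List (ℝ × List (Fin n)) → List (Fin n × ℝ)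
  | [] => []
  | x :: l => partsRun loc s l ++ pathStops loc s x.1 x.2

theorem val_loop_emitPath (loc : Fin n → V) (s : ℝ) (rest : List (Fin n × ℝ))
    (l : List (ℝ × List (Fin n))) :
    (Timed.loop (fun R x => emitPath loc s R x.1 x.2) rest l).val = partsRun loc s l ++ rest := by
  induction l generalizing rest with
  | nil => rfl
  | cons x l ih => simp [ih, partsRun, val_emitPath]

theorem sum_length_parts (loc : Fin n → V) (s : ℝ) (l : List (ℝ × List (Fin n))) :
    (l.map fun x => x.2.length).sum = (partsRun loc s l).length := by
  induction l with
  | nil => rfl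
  | cons x l ih => simp [partsRun, ih, length_pathStops, add_comm]

end Paths

/-! ## Tables of partial runs -/

namespace RunTable

variable {n : ℕ}

/-- All partial runs in the table have the property `Φ`. -/
def All (T : RunTable n) (Φ : Fin n → ℕ → PartialRun n → Prop) : Prop :=
  ∀ v π x, T v π = some x → Φ v π x

/-- The table has a partial run to `v` with profit `π` that ends at time `t` or earlier. -/
def Reaches (T : RunTable n) (v : Fin n) (π : ℕ) (t : ℝ) : Prop :=
  ∃ x, T v π = some x ∧ x.time ≤ t

theorem Reaches.mono {T : RunTable n} {v : Fin n} {π : ℕ} {t t' : ℝ} (h : T.Reaches v π t)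
    (ht : t ≤ t') : T.Reaches v π t' := by
  obtain ⟨x, hx, hxt⟩ := h
  exact ⟨x, hx, hxt.trans ht⟩

end RunTable

section Relax

variable {n : ℕ}

open RunTable

theorem update_entry_apply (T : RunTable n) (v w : Fin n) (π ρ : ℕ) (x : Option (PartialRun n)) :
    Function.update T v (Function.update (T v) π x) w ρ = if w = v ∧ ρ = π then x else T w ρ := by
  by_cases hw : w = v
  · subst hw
    by_cases hρ : ρ = π
    · simp [hρ]
    · simp [hρ]
  · simp [hw]

theorem relax_all {T : RunTable n} {Φ : Fin n → ℕ → PartialRun n → Prop} (hT : T.All Φ)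
    {v : Fin n} {π : ℕ} {x : PartialRun n} (hx : Φ v π x) : (relax T v π x).val.All Φ := by
  have key : RunTable.All (Function.update T v (Function.update (T v) π (some x))) Φ := by
    intro w ρ y hy
    rw [update_entry_apply] at hy
    split_ifs at hy with h
    · obtain ⟨rfl, rfl⟩ := h
      rw [← Option.some.inj hy]; exact hx
    · exact hT w ρ y hy
  simp only [relax, Timed.val_step]
  split
  · exact key
  · split_ifs
    · exact key
    · exact hT

theorem relax_reaches_self (T : RunTable n) (v : Fin n) (π : ℕ) (x : PartialRun n) :
    (relax T v π x).val.Reaches v π x.time := by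
  simp only [relax, Timed.val_step]
  split
  · exact ⟨x, by simp, le_rfl⟩
  · next y hy =>
    split_ifs with h
    · exact ⟨x, by simp, le_rfl⟩
    · exact ⟨y, hy, not_lt.1 h⟩

/-- An entry is only ever replaced by one that ends earlier. Optimality is therefore tracked through
`Reaches`, which survives all later updates, and not through particular entries. -/
theorem relax_reaches_mono {T : RunTable n} {w : Fin n} {ρ : ℕ} {t : ℝ} (hT : T.Reaches w ρ t)
    (v : Fin n) (π : ℕ) (x : PartialRun n) : (relax T v π x).val.Reaches w ρ t := by
  obtain ⟨y, hy, hyt⟩ := hT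
  by_cases h : w = v ∧ ρ = π
  · obtain ⟨rfl, rfl⟩ := h
    simp only [relax, Timed.val_step, hy]
    split_ifs with h'
    · exact ⟨x, by simp, h'.le.trans hyt⟩
    · exact ⟨y, hy, hyt⟩
  · have key : RunTable.Reaches (Function.update T v (Function.update (T v) π (some x))) w ρ t :=
      ⟨y, by rw [update_entry_apply, if_neg h, hy], hyt⟩
    simp only [relax, Timed.val_step]
    split
    · exact key
    · split_ifs
      · exact key
      · exact ⟨y, hy, hyt⟩

@[simp] theorem steps_relax (T : RunTable n) (v : Fin n) (π : ℕ) (x : PartialRun n) :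
    (relax T v π x).steps = 1 := rfl

variable {V : Type*} [MetricSpace V]

/-! ### What the tables of a period contain and reach -/

theorem entryTable_all {loc : Fin n → V} {s a : ℝ} {P : List (Fin n)} {T : RunTable n}
    {Φ : Fin n → ℕ → PartialRun n → Prop} (h0 : ∀ u ∈ P, Φ u 0 ⟨a, []⟩)
    (h : ∀ u ∈ P, ∀ w π x, T w π = some x →
      Φ u π ⟨max a (x.time + dist (loc w) (loc u) / s), x.parts⟩) :
    (entryTable loc s a P T).val.All Φ := by
  refine Timed.loop_invariant (p := fun E : RunTable n => E.All Φ) ?_ ?_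
  · intro v π x hx
    cases hx
  · intro E u hu hE
    refine Timed.loop_invariant (p := fun E : RunTable n => E.All Φ) (relax_all hE (h0 u hu)) ?_
    intro E w _ hE
    refine Timed.loop_invariant (p := fun E : RunTable n => E.All Φ) hE ?_
    intro E π _ hE
    split
    · exact hE
    · next x hx => exact relax_all hE (h u hu w π x hx)

/-- The work that `entryTable` does for the request `u`. -/
def entryStep (loc : Fin n → V) (s a : ℝ) (T E : RunTable n) (u : Fin n) : Timed (RunTable n) := do
  let E ← relax E u 0 ⟨a, []⟩
  Timed.loop (fun E w =>
    Timed.loop (fun E π =>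
      match T w π with
      | none => Timed.step E
      | some x => relax E u π ⟨max a (x.time + dist (loc w) (loc u) / s), x.parts⟩)
      E (List.range (n + 1)))
    E (List.finRange n)

theorem entryTable_eq (loc : Fin n → V) (s a : ℝ) (P : List (Fin n)) (T : RunTable n) :
    entryTable loc s a P T = (do
      let E ← newTable n
      Timed.loop (entryStep loc s a T) E P) := rfl

theorem entryStep_reaches_mono {loc : Fin n → V} {s a : ℝ} {T E : RunTable n} {u w : Fin n} {ρ : ℕ}
    {t : ℝ} (h : E.Reaches w ρ t) : (entryStep loc s a T E u).val.Reaches w ρ t := by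
  refine Timed.loop_invariant (p := fun E : RunTable n => E.Reaches w ρ t)
    (relax_reaches_mono h _ _ _) ?_
  intro E w _ hE
  refine Timed.loop_invariant (p := fun E : RunTable n => E.Reaches _ ρ t) hE ?_
  intro E π _ hE
  split
  · exact hE
  · exact relax_reaches_mono hE _ _ _

theorem entryTable_reaches_start {loc : Fin n → V} {s a : ℝ} {P : List (Fin n)} {T : RunTable n}
    {u : Fin n} (hu : u ∈ P) : (entryTable loc s a P T).val.Reaches u 0 a := by
  rw [entryTable_eq]
  refine Timed.loop_establishes (p := fun _ => True) (q := fun E : RunTable n => E.Reaches u 0 a)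
    hu trivial (fun _ _ _ _ => trivial) ?_ fun E a _ hE => entryStep_reaches_mono hE
  intro E _
  refine Timed.loop_invariant (p := fun E : RunTable n => E.Reaches u 0 a)
    (relax_reaches_self _ _ _ _) ?_
  intro E w _ hE
  refine Timed.loop_invariant (p := fun E : RunTable n => E.Reaches _ 0 a) hE ?_
  intro E π _ hE
  split
  · exact hE
  · exact relax_reaches_mono hE _ _ _

/-- In each of the three nested loops one iteration matters, namely `u`, `w` and `π`; all others
preserve `Reaches`. The bound `π ≤ n` ensures that the innermost loop arrives at `π`. -/
theorem entryTable_reaches {loc : Fin n → V} {s a : ℝ} {P : List (Fin n)} {T : RunTable n}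
    {u w : Fin n} {π : ℕ} {x : PartialRun n} (hu : u ∈ P) (hπ : π ≤ n) (hx : T w π = some x) :
    (entryTable loc s a P T).val.Reaches u π (max a (x.time + dist (loc w) (loc u) / s)) := by
  set t := max a (x.time + dist (loc w) (loc u) / s) with ht
  have inner : ∀ (w' : Fin n) (E : RunTable n), E.Reaches u π t →
      (Timed.loop (fun E π => match T w' π with
        | none => Timed.step E
        | some x => relax E u π ⟨max a (x.time + dist (loc w') (loc u) / s), x.parts⟩)
        E (List.range (n + 1))).val.Reaches u π t := by
    intro w' E hE
    refine Timed.loop_invariant (p := fun E : RunTable n => E.Reaches u π t) hE ?_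
    intro E π _ hE
    split
    · exact hE
    · exact relax_reaches_mono hE _ _ _
  rw [entryTable_eq]
  refine Timed.loop_establishes (p := fun _ => True) (q := fun E : RunTable n => E.Reaches u π t)
    hu trivial (fun _ _ _ _ => trivial) ?_ fun E a _ hE => entryStep_reaches_mono hE
  intro E _
  refine Timed.loop_establishes (p := fun _ => True) (q := fun E : RunTable n => E.Reaches u π t)
    (List.mem_finRange w) trivial (fun _ _ _ _ => trivial) ?_ fun E w' _ hE => inner w' E hE
  intro E _
  refine Timed.loop_establishes (p := fun _ => True) (q := fun E : RunTable n => E.Reaches u π t)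
    (List.mem_range.2 (Nat.lt_succ_of_le hπ)) trivial (fun _ _ _ _ => trivial) ?_ ?_
  · intro E _
    simp only [hx]
    exact relax_reaches_self _ _ _ _
  · intro E ρ _ hE
    split
    · exact hE
    · exact relax_reaches_mono hE _ _ _

/-- The work that `extendTable` does for a path `l` from `u` to `v`. -/
def extendPath (loc : Fin n → V) (s b : ℝ) (E : RunTable n) (u v : Fin n) (T : RunTable n) :
    List (Fin n) → Timed (RunTable n)
  | [] => Timed.step T
  | p :: l => do
    let x ← measurePath loc (p :: l)
    Timed.loop (fun T π =>
      match E u π with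
      | none => Timed.step T
      | some y =>
          if y.time + x.1 / s < b then
            relax T v (π + x.2) ⟨y.time + x.1 / s, (y.time, p :: l) :: y.parts⟩
          else Timed.step T)
      T (List.range (n + 1))

theorem extendTable_eq (loc : Fin n → V) (s b : ℝ) (P : List (Fin n))
    (paths : Fin n → Fin n → ℕ → List (Fin n)) (E T : RunTable n) :
    extendTable loc s b P paths E T =
      Timed.loop (fun T u => Timed.loop (fun T v => Timed.loop (fun T k =>
        extendPath loc s b E u v T (paths u v (k + 1))) T (List.range P.length)) T P) T P := rfl

theorem extendPath_all {loc : Fin n → V} {s b : ℝ} {E T : RunTable n} {u v : Fin n}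
    {l : List (Fin n)} {Φ : Fin n → ℕ → PartialRun n → Prop} (hT : T.All Φ)
    (h : ∀ π y, l ≠ [] → E u π = some y → y.time + pathLength loc l / s < b →
      Φ v (π + l.length) ⟨y.time + pathLength loc l / s, (y.time, l) :: y.parts⟩) :
    (extendPath loc s b E u v T l).val.All Φ := by
  cases l with
  | nil => exact hT
  | cons p l =>
    simp only [extendPath, Timed.val_bind, val_measurePath]
    refine Timed.loop_invariant (p := fun T : RunTable n => T.All Φ) hT ?_
    intro T π _ hT
    split
    · exact hT
    · next y hy =>
      split_ifs with hb
      · exact relax_all hT (h π y (by simp) hy hb)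
      · exact hT

theorem extendPath_reaches_mono {loc : Fin n → V} {s b : ℝ} {E T : RunTable n} {u v w : Fin n}
    {l : List (Fin n)} {ρ : ℕ} {t : ℝ} (hT : T.Reaches w ρ t) :
    (extendPath loc s b E u v T l).val.Reaches w ρ t := by
  cases l with
  | nil => exact hT
  | cons p l =>
    refine Timed.loop_invariant (p := fun T : RunTable n => T.Reaches w ρ t) hT ?_
    intro T π _ hT
    split
    · exact hT
    · split_ifs with hb
      · exact relax_reaches_mono hT _ _ _
      · exact hT

theorem extendPath_reaches {loc : Fin n → V} {s b : ℝ} {E T : RunTable n} {u v : Fin n}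
    {l : List (Fin n)} {π : ℕ} {y : PartialRun n} (hl : l ≠ []) (hπ : π ≤ n)
    (hy : E u π = some y) (hb : y.time + pathLength loc l / s < b) :
    (extendPath loc s b E u v T l).val.Reaches v (π + l.length)
      (y.time + pathLength loc l / s) := by
  cases l with
  | nil => exact absurd rfl hl
  | cons p l =>
    simp only [extendPath, Timed.val_bind, val_measurePath]
    refine Timed.loop_establishes (p := fun _ => True)
      (q := fun T : RunTable n => T.Reaches v (π + (p :: l).length)
        (y.time + pathLength loc (p :: l) / s))
      (List.mem_range.2 (Nat.lt_succ_of_le hπ)) trivial (fun _ _ _ _ => trivial) ?_ ?_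
    · intro T _
      simp only [hy, if_pos hb]
      exact relax_reaches_self _ _ _ _
    · intro T π _ hT
      split
      · exact hT
      · split_ifs
        · exact relax_reaches_mono hT _ _ _
        · exact hT

theorem extendTable_all {loc : Fin n → V} {s b : ℝ} {P : List (Fin n)}
    {paths : Fin n → Fin n → ℕ → List (Fin n)} {E T : RunTable n}
    {Φ : Fin n → ℕ → PartialRun n → Prop} (hT : T.All Φ)
    (h : ∀ u ∈ P, ∀ v ∈ P, ∀ k l, paths u v k = l → l ≠ [] → ∀ π y, E u π = some y →
      y.time + pathLength loc l / s < b →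
      Φ v (π + l.length) ⟨y.time + pathLength loc l / s, (y.time, l) :: y.parts⟩) :
    (extendTable loc s b P paths E T).val.All Φ := by
  rw [extendTable_eq]
  refine Timed.loop_invariant (p := fun T : RunTable n => T.All Φ) hT fun T u hu hT => ?_
  refine Timed.loop_invariant (p := fun T : RunTable n => T.All Φ) hT fun T v hv hT => ?_
  refine Timed.loop_invariant (p := fun T : RunTable n => T.All Φ) hT fun T k _ hT => ?_
  exact extendPath_all hT fun π y hl hy hb => h u hu v hv (k + 1) _ rfl hl π y hy hb

theorem extendTable_reaches_mono {loc : Fin n → V} {s b : ℝ} {P : List (Fin n)}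
    {paths : Fin n → Fin n → ℕ → List (Fin n)} {E T : RunTable n} {w : Fin n} {ρ : ℕ} {t : ℝ}
    (hT : T.Reaches w ρ t) : (extendTable loc s b P paths E T).val.Reaches w ρ t := by
  rw [extendTable_eq]
  refine Timed.loop_invariant (p := fun T : RunTable n => T.Reaches w ρ t) hT fun T u hu hT => ?_
  refine Timed.loop_invariant (p := fun T : RunTable n => T.Reaches w ρ t) hT fun T v hv hT => ?_
  refine Timed.loop_invariant (p := fun T : RunTable n => T.Reaches w ρ t) hT fun T k _ hT => ?_
  exact extendPath_reaches_mono hT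

theorem extendTable_reaches {loc : Fin n → V} {s b : ℝ} {P : List (Fin n)}
    {paths : Fin n → Fin n → ℕ → List (Fin n)} {E T : RunTable n} {u v : Fin n} {k : ℕ}
    {l : List (Fin n)} {π : ℕ} {y : PartialRun n} (hu : u ∈ P) (hv : v ∈ P) (hk : k < P.length)
    (hpath : paths u v (k + 1) = l) (hl : l ≠ []) (hπ : π ≤ n) (hy : E u π = some y)
    (hb : y.time + pathLength loc l / s < b) :
    (extendTable loc s b P paths E T).val.Reaches v (π + l.length)
      (y.time + pathLength loc l / s) := by
  rw [extendTable_eq]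
  let q := fun T : RunTable n => T.Reaches v (π + l.length) (y.time + pathLength loc l / s)
  refine Timed.loop_establishes (p := fun _ => True) (q := q) hu trivial (fun _ _ _ _ => trivial)
    (fun T _ => ?_) fun T u _ hT => ?_
  · refine Timed.loop_establishes (p := fun _ => True) (q := q) hv trivial
      (fun _ _ _ _ => trivial) (fun T _ => ?_) fun T v _ hT => ?_
    · refine Timed.loop_establishes (p := fun _ => True) (q := q) (List.mem_range.2 hk) trivial
        (fun _ _ _ _ => trivial) (fun T _ => ?_) fun T k _ hT => extendPath_reaches_mono hT
      rw [hpath]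
      exact extendPath_reaches hl hπ hy hb
    · exact Timed.loop_invariant (p := q) hT fun T k _ hT => extendPath_reaches_mono hT
  · refine Timed.loop_invariant (p := q) hT fun T v _ hT => ?_
    exact Timed.loop_invariant (p := q) hT fun T k _ hT => extendPath_reaches_mono hT

/-- The initial value `(0, [])` survives when no entry has positive profit, since an update requires
a strict improvement. -/
theorem bestEntry_mem (T : RunTable n) :
    (bestEntry T).val = (0, []) ∨
      (bestEntry T).val.1 ≤ n ∧
        ∃ v x, T v (bestEntry T).val.1 = some x ∧ (bestEntry T).val.2 = x.parts := by
  let p := fun B : ℕ × List (ℝ × List (Fin n)) =>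
    B = (0, []) ∨ B.1 ≤ n ∧ ∃ v x, T v B.1 = some x ∧ B.2 = x.parts
  refine Timed.loop_invariant (p := p) (Or.inl rfl) fun B v _ hB => ?_
  refine Timed.loop_invariant (p := p) hB fun B π hπ hB => ?_
  split
  · exact hB
  · next x hx =>
    rw [Timed.val_step]
    split_ifs
    · exact Or.inr ⟨Nat.lt_succ_iff.1 (List.mem_range.1 hπ), v, x, hx, rfl⟩
    · exact hB

theorem le_bestEntry {T : RunTable n} {v : Fin n} {π : ℕ} {x : PartialRun n} (hπ : π ≤ n)
    (hx : T v π = some x) : π ≤ (bestEntry T).val.1 := by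
  let q := fun B : ℕ × List (ℝ × List (Fin n)) => π ≤ B.1
  have hmono : ∀ (w : Fin n) (B : ℕ × List (ℝ × List (Fin n))) (ρ : ℕ), q B →
      q (match T w ρ with
      | none => Timed.step B
      | some x => Timed.step (if B.1 < ρ then (ρ, x.parts) else B)).val := by
    intro w B ρ hB
    split
    · exact hB
    · rw [Timed.val_step]
      split_ifs with h
      · exact hB.trans h.le
      · exact hB
  refine Timed.loop_establishes (p := fun _ => True) (q := q) (List.mem_finRange v) trivial
    (fun _ _ _ _ => trivial) (fun B _ => ?_)
    fun B w _ hB => Timed.loop_invariant (p := q) hB fun B ρ _ hB => hmono w B ρ hB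
  refine Timed.loop_establishes (p := fun _ => True) (q := q)
    (List.mem_range.2 (Nat.lt_succ_of_le hπ)) trivial
    (fun _ _ _ _ => trivial) (fun B _ => ?_) fun B ρ _ hB => hmono v B ρ hB
  simp only [hx, Timed.val_step, q]
  split_ifs with h
  · exact le_rfl
  · exact not_lt.1 h

end Relax

end

noncomputable section

/-! ## The repairman algorithm pastes together an approximately best run -/

section Repairman

variable {V : Type*} [MetricSpace V] {n : ℕ}

/-- Insert the period to which `p` is trimmed into a strictly increasing list. -/
def insertPeriod (per : Fin n → Option ℤ) (acc : List ℤ) (p : Fin n) : Timed (List ℤ) :=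
  match per p with
  | none => Timed.step acc
  | some i => Timed.insertSorted i acc

/-- The indices of the periods to which requests are trimmed. -/
def usedPeriods (per : Fin n → Option ℤ) : Timed (List ℤ) :=
  Timed.loop (insertPeriod per) [] (List.finRange n)

/-- The requests that are trimmed to a period. -/
def periodRequests (per : Fin n → Option ℤ) (i : ℤ) : Timed (List (Fin n)) :=
  Timed.loop (fun acc p =>
    Timed.step (if per p = some i then p :: acc else acc)) [] (List.finRange n)

/-- The work of the repairman algorithm for one period. -/
def periodStep (F : PathFinder V) (loc : Fin n → V) (s α τ : ℝ) (per : Fin n → Option ℤ)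
    (T : RunTable n) (i : ℤ) : Timed (RunTable n) := do
  let P ← periodRequests per i
  let paths ← F n loc P
  let E ← entryTable loc s (τ + i * α) P T
  extendTable loc s (τ + (i + 1) * α) P paths E T

theorem repairman_eq (F : PathFinder V) (loc : Fin n → V) (s α τ : ℝ) (per : Fin n → Option ℤ) :
    repairman F loc s α τ per = (do
      let periods ← usedPeriods per
      let T ← newTable n
      let T ← Timed.loop (periodStep F loc s α τ per) T periods
      let best ← bestEntry T
      let R ← Timed.loop (fun R x => emitPath loc s R x.1 x.2) [] best.2
      pure (best.1, R)) := rfl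

theorem pairwise_insertPeriod (per : Fin n → Option ℤ) {acc : List ℤ} (p : Fin n)
    (h : acc.Pairwise (· < ·)) : (insertPeriod per acc p).val.Pairwise (· < ·) := by
  rw [insertPeriod]
  split
  · exact h
  · exact Timed.pairwise_insertSorted _ h

theorem mem_insertPeriod (per : Fin n → Option ℤ) (acc : List ℤ) (p : Fin n) (i : ℤ) :
    i ∈ (insertPeriod per acc p).val ↔ i ∈ acc ∨ per p = some i := by
  rw [insertPeriod]
  split
  · next h => simp [h]
  · next j h => simp [h, Timed.mem_insertSorted, or_comm, eq_comm]

theorem mem_loop_insertPeriod (per : Fin n → Option ℤ) (l : List (Fin n)) (acc : List ℤ) (i : ℤ) :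
    i ∈ (Timed.loop (insertPeriod per) acc l).val ↔ i ∈ acc ∨ ∃ p ∈ l, per p = some i := by
  induction l generalizing acc with
  | nil => simp
  | cons p l ih => simp [ih, mem_insertPeriod, or_assoc]

theorem pairwise_usedPeriods (per : Fin n → Option ℤ) : (usedPeriods per).val.Pairwise (· < ·) :=
  Timed.loop_invariant (p := fun acc : List ℤ => acc.Pairwise (· < ·)) List.Pairwise.nil
    fun _ p _ h => pairwise_insertPeriod per p h

theorem mem_usedPeriods {per : Fin n → Option ℤ} {i : ℤ} :
    i ∈ (usedPeriods per).val ↔ ∃ p, per p = some i := by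
  simp [usedPeriods, mem_loop_insertPeriod]

theorem val_periodRequests (per : Fin n → Option ℤ) (i : ℤ) :
    (periodRequests per i).val = ((List.finRange n).filter fun p => per p = some i).reverse := by
  have h : ∀ (l acc : List (Fin n)), (Timed.loop (fun acc p =>
      Timed.step (if per p = some i then p :: acc else acc)) acc l).val =
        (l.filter fun p => per p = some i).reverse ++ acc := by
    intro l
    induction l with
    | nil => intro acc; rfl
    | cons p l ih =>
      intro acc
      rw [Timed.val_loop_cons, ih]
      by_cases hp : per p = some i <;> simp [hp]
  rw [periodRequests, h, List.append_nil]

theorem nodup_periodRequests (per : Fin n → Option ℤ) (i : ℤ) :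
    (periodRequests per i).val.Nodup := by
  rw [val_periodRequests, List.nodup_reverse]
  exact (List.nodup_finRange n).filter _

theorem mem_periodRequests {per : Fin n → Option ℤ} {i : ℤ} {p : Fin n} :
    p ∈ (periodRequests per i).val ↔ per p = some i := by
  simp [val_periodRequests]

/-- `parts` is the list of the paths, the latest one first, of a service run of profit `π` in
periods with property `K`. -/
structure IsValidParts (I : RepairInstance V n) (s : ℝ) (per : Fin n → Option ℤ) (K : ℤ → Prop)
    (π : ℕ) (parts : List (ℝ × List (Fin n))) : Prop where
  isServiceRun : I.IsServiceRun s (partsRun I.loc s parts)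
  length_eq : (partsRun I.loc s parts).length = π
  per_mem : ∀ z ∈ partsRun I.loc s parts, ∃ i, per z.1 = some i ∧ K i
  ne_nil : ∀ x ∈ parts, x.2 ≠ []

variable {I : RepairInstance V n} {s : ℝ} {per : Fin n → Option ℤ}

theorem RepairInstance.IsServiceRun.length_le {R : List (Fin n × ℝ)} (h : I.IsServiceRun s R) :
    R.length ≤ n := by
  have := h.1.length_le_card
  simpa using this

theorem IsValidParts.nil (K : ℤ → Prop) : IsValidParts I s per K 0 [] :=
  ⟨⟨List.nodup_nil, by simp [partsRun], List.IsChain.nil⟩, rfl, by simp [partsRun], by simp⟩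

theorem IsValidParts.mono {K K' : ℤ → Prop} {π : ℕ} {parts : List (ℝ × List (Fin n))}
    (h : IsValidParts I s per K π parts) (hK : ∀ i, K i → K' i) :
    IsValidParts I s per K' π parts :=
  ⟨h.1, h.2, fun z hz => (h.3 z hz).imp fun _ hi => ⟨hi.1, hK _ hi.2⟩, h.4⟩

/-- Since the period `i` is new, its requests differ from all earlier ones. The windows contain
their periods by `hper`, so staying in the period suffices for the times. At the joint, only the
distance from the last earlier stop has to be checked. -/
theorem IsValidParts.cons (hs : 0 < s) {α τ : ℝ}
    (hper : ∀ p i, per p = some i → I.start p ≤ τ + i * α ∧ τ + (i + 1) * α ≤ I.finish p)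
    {K : ℤ → Prop} {π : ℕ} {parts : List (ℝ × List (Fin n))}
    (h : IsValidParts I s per K π parts) {i : ℤ} (hi : ¬ K i) {l : List (Fin n)} {t : ℝ}
    {u : Fin n} (hl : l.Nodup) (hli : ∀ p ∈ l, per p = some i) (hu : l.head? = some u)
    (hta : τ + i * α ≤ t) (htb : t + pathLength I.loc l / s < τ + (i + 1) * α)
    (hz : ∀ z ∈ (partsRun I.loc s parts).getLast?, dist (I.loc z.1) (I.loc u) ≤ s * (t - z.2)) :
    IsValidParts I s per (fun j => K j ∨ j = i) (π + l.length) ((t, l) :: parts) := by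
  have hmem : ∀ z ∈ pathStops I.loc s t l, per z.1 = some i := fun z hz =>
    hli _ (by rw [← map_fst_pathStops I.loc s t l]; exact List.mem_map_of_mem hz)
  refine ⟨⟨?_, ?_, ?_⟩, ?_, ?_, ?_⟩
  · rw [partsRun, List.map_append, map_fst_pathStops, List.nodup_append']
    refine ⟨h.1.1, hl, ?_⟩
    intro p hp hpl
    obtain ⟨z, hz, rfl⟩ := List.mem_map.1 hp
    obtain ⟨j, hj, hKj⟩ := h.per_mem z hz
    rw [hli _ hpl] at hj
    exact hi (Option.some.inj hj ▸ hKj)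
  · intro z hz
    rcases List.mem_append.1 hz with hz | hz
    · exact h.1.2.1 z hz
    · have h1 := hper _ _ (hmem z hz)
      have h2 := mem_pathStops_time hs t l z hz
      constructor <;> linarith
  · rw [partsRun, List.isChain_append]
    refine ⟨h.1.2.2, isChain_pathStops hs t l, ?_⟩
    intro z hz' w hw
    rw [head?_pathStops, hu] at hw
    simp only [Option.map_some, Option.mem_some] at hw
    subst hw
    exact hz z hz'
  · rw [partsRun, List.length_append, h.length_eq, length_pathStops]
  · intro z hz
    rcases List.mem_append.1 hz with hz | hz
    · exact (h.per_mem z hz).imp fun _ hj => ⟨hj.1, Or.inl hj.2⟩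
    · exact ⟨i, hmem z hz, Or.inr rfl⟩
  · intro x hx
    rcases List.mem_cons.1 hx with rfl | hx
    · rintro rfl; simp at hu
    · exact h.ne_nil x hx

/-- The partial runs in the table are service runs in periods with property `K`. -/
def RunTable.IsSound (I : RepairInstance V n) (s : ℝ) (per : Fin n → Option ℤ) (K : ℤ → Prop)
    (T : RunTable n) : Prop :=
  T.All fun v π x => IsValidParts I s per K π x.parts ∧
    (partsRun I.loc s x.parts).getLast? = some (v, x.time)

/-! ### Soundness and domination in the dynamic program -/

variable {F : PathFinder V} {γ α τ : ℝ} {K : ℤ → Prop} {T : RunTable n} {i : ℤ}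

/-- These are the conditions under which `IsValidParts.cons` can append a path beginning at `u`. The
condition on the last stop is vacuous for a run that starts afresh in this period. -/
theorem entryTable_isSound (hs : 0 < s) (hT : T.IsSound I s per K) (P : List (Fin n)) (a : ℝ) :
    (entryTable I.loc s a P T).val.All fun u π y => IsValidParts I s per K π y.parts ∧
      a ≤ y.time ∧ ∀ z ∈ (partsRun I.loc s y.parts).getLast?,
        dist (I.loc z.1) (I.loc u) ≤ s * (y.time - z.2) := by
  refine entryTable_all ?_ ?_
  · intro u _
    exact ⟨IsValidParts.nil K, le_rfl, by simp [partsRun]⟩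
  · intro u _ w π x hx
    obtain ⟨h1, h2⟩ := hT w π x hx
    refine ⟨h1, le_max_left _ _, ?_⟩
    intro z hz
    rw [h2, Option.mem_some] at hz
    subst hz
    have h3 : x.time + dist (I.loc w) (I.loc u) / s ≤
      max a (x.time + dist (I.loc w) (I.loc u) / s) := le_max_right _ _
    have h4 := mul_le_mul_of_nonneg_left h3 hs.le
    rw [mul_add, mul_div_cancel₀ _ hs.ne'] at h4
    simp only
    linarith

theorem periodStep_isSound (hF : F.IsApprox γ) (hs : 0 < s)
    (hper : ∀ p i, per p = some i → I.start p ≤ τ + i * α ∧ τ + (i + 1) * α ≤ I.finish p)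
    (hT : T.IsSound I s per K) (hi : ¬ K i) :
    (periodStep F I.loc s α τ per T i).val.IsSound I s per (fun j => K j ∨ j = i) := by
  refine extendTable_all ?_ ?_
  · intro v π x hx
    exact ⟨(hT v π x hx).1.mono fun _ => Or.inl, (hT v π x hx).2⟩
  · intro u hu v hv k l hl hne π y hy hb
    obtain ⟨h1, h2, h3⟩ := entryTable_isSound hs hT _ _ u π y hy
    have hpath := ((hF n I.loc _ (nodup_periodRequests per i) u hu v hv).1 k).resolve_left
      (hl ▸ hne)
    rw [hl] at hpath
    refine ⟨h1.cons hs hper hi hpath.1 (fun p hp => mem_periodRequests.1 (hpath.2.1 p hp))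
      hpath.2.2.1 h2 hb h3, ?_⟩
    rw [partsRun, List.getLast?_append, getLast?_pathStops, hpath.2.2.2]
    rfl

/-- For each period `i`, the list `S i` of stops in this period, so that the lists together form
a run at speed `s`. -/
structure IsSchedule (loc : Fin n → V) (s α τ : ℝ) (per : Fin n → Option ℤ)
    (S : ℤ → List (Fin n × ℝ)) : Prop where
  nodup : ∀ i, ((S i).map Prod.fst).Nodup
  per_eq : ∀ i, ∀ z ∈ S i, per z.1 = some i
  time_mem : ∀ i : ℤ, ∀ z ∈ S i, τ + i * α ≤ z.2 ∧ z.2 < τ + (i + 1) * α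
  isChain : ∀ i, (S i).IsChain fun x y => dist (loc x.1) (loc y.1) ≤ s * (y.2 - x.2)
  dist_le : ∀ i j, i < j → ∀ x ∈ S i, ∀ y ∈ S j, dist (loc x.1) (loc y.1) ≤ s * (y.2 - x.2)

/-- The table has a partial run that ends no later than one of the stops in `S` and whose profit is
at least `1 / γ` times `N`. -/
def RunTable.Dominates (γ : ℝ) (S : ℤ → List (Fin n × ℝ)) (K : ℤ → Prop) (N : ℕ)
    (T : RunTable n) : Prop :=
  N = 0 ∨ ∃ v π t, T.Reaches v π t ∧ (N : ℝ) ≤ γ * π ∧ ∃ j, K j ∧ (v, t) ∈ S j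

/-- Exchange argument: let the schedule go from `x` to `y` in this period. The dominating partial
run reaches `x` no later than the schedule does, and the path of `F` from `x` to `y` is no longer
than the schedule's, so `y` is reached in time. The profits of the two pieces add up, each within
the factor `γ`. -/
theorem periodStep_dominates (hF : F.IsApprox γ) (hs : 0 < s) (hT : T.IsSound I s per K)
    {S : ℤ → List (Fin n × ℝ)} (hS : IsSchedule I.loc s α τ per S) (hi : ∀ j, K j → j < i)
    {N : ℕ} (hN : T.Dominates γ S K N) :
    (periodStep F I.loc s α τ per T i).val.Dominates γ S (fun j => K j ∨ j = i)
      (N + (S i).length) := by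
  by_cases hnil : S i = []
  · rw [hnil]
    refine hN.imp id ?_
    rintro ⟨v, π, t, h1, h2, j, h3, h4⟩
    exact ⟨v, π, t, extendTable_reaches_mono h1, h2, j, Or.inl h3, h4⟩
  obtain ⟨x, hx⟩ : ∃ x, (S i).head? = some x := ⟨_, List.head?_eq_some_head hnil⟩
  obtain ⟨y, hy⟩ : ∃ y, (S i).getLast? = some y := ⟨_, List.getLast?_eq_some_getLast hnil⟩
  have hxS : x ∈ S i := List.mem_of_mem_head? hx
  have hyS : y ∈ S i := List.mem_of_mem_getLast? hy
  set P := (periodRequests per i).val with hP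
  set a := τ + i * α with ha
  have hxP : x.1 ∈ P := mem_periodRequests.2 (hS.per_eq i x hxS)
  have hyP : y.1 ∈ P := mem_periodRequests.2 (hS.per_eq i y hyS)
  have hQ : IsPath P x.1 y.1 ((S i).map Prod.fst) := by
    refine ⟨hS.nodup i, ?_, by simp [hx], by simp [hy]⟩
    intro p hp
    obtain ⟨z, hz, rfl⟩ := List.mem_map.1 hp
    exact mem_periodRequests.2 (hS.per_eq i z hz)
  obtain ⟨hpath, hlen, hprofit⟩ :=
    (hF n I.loc P (nodup_periodRequests per i) x.1 hxP y.1 hyP).2 _ hQ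
  rw [List.length_map] at hpath hlen hprofit
  -- `extendTable` looks up the paths for `k + 1` with `k < P.length`, so the number of stops is
  -- written as a successor.
  obtain ⟨k, hk⟩ : ∃ k, (S i).length = k + 1 :=
    Nat.exists_eq_succ_of_ne_zero (by simpa using hnil)
  have hkP : k < P.length := by
    have := (hS.nodup i).length_le_of_subset hQ.2.1
    rw [List.length_map] at this
    omega
  set l := (F n I.loc P).val x.1 y.1 (S i).length with hl
  have hlne : l ≠ [] := by
    intro h
    have := hpath.2.2.1
    simp [h] at this
  have hlen' : pathLength I.loc l / s ≤ y.2 - x.2 := by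
    rw [div_le_iff₀' hs]
    exact hlen.trans (pathLength_le_of_isChain _ (hS.isChain i) x hx y hy)
  have hta := (hS.time_mem i x hxS).1
  have htb := (hS.time_mem i y hyS).2
  obtain ⟨π, hπn, hreach, hγ⟩ : ∃ π ≤ n, (entryTable I.loc s a P T).val.Reaches x.1 π x.2 ∧
      (N : ℝ) ≤ γ * π := by
    -- If nothing has been serviced, a run starts afresh at the beginning `a` of the period;
    -- otherwise the dominating partial run continues from its last stop.
    rcases hN with rfl | ⟨v, π, t, ⟨w, hw, hwt⟩, h2, j, h3, h4⟩
    · exact ⟨0, Nat.zero_le _, (entryTable_reaches_start hxP).mono hta, by simp⟩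
    · have hv := (hT v π w hw).1
      -- Soundness bounds the profit, so this entry lies in the range that the loops inspect.
      have hπ : π ≤ n := hv.length_eq ▸ hv.isServiceRun.length_le
      refine ⟨π, hπ, (entryTable_reaches hxP hπ hw).mono (max_le hta ?_), h2⟩
      have h5 := hS.dist_le j i (hi j h3) _ h4 x hxS
      have h6 : dist (I.loc v) (I.loc x.1) / s ≤ x.2 - t := by
        rw [div_le_iff₀' hs]; exact h5
      linarith
  obtain ⟨e, he, hex⟩ := hreach
  right
  refine ⟨y.1, π + l.length, y.2, ?_, ?_, i, Or.inr rfl, hyS⟩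
  · refine RunTable.Reaches.mono (extendTable_reaches hxP hyP hkP ?_ hlne hπn he ?_) ?_
    · rw [hl, hk]
    · linarith
    · linarith
  · push_cast
    rw [mul_add]
    exact add_le_add hγ hprofit

/-- The two invariants go together because domination uses soundness. Here `K` stands for the
periods already processed; increasing order makes each next period new and later than all of them.
-/
theorem loop_periodStep_spec (hF : F.IsApprox γ) (hs : 0 < s)
    (hper : ∀ p i, per p = some i → I.start p ≤ τ + i * α ∧ τ + (i + 1) * α ≤ I.finish p)
    {S : ℤ → List (Fin n × ℝ)} (hS : IsSchedule I.loc s α τ per S) (l : List ℤ) (K : ℤ → Prop)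
    (T : RunTable n) (N : ℕ) (hl : l.Pairwise (· < ·)) (hK : ∀ j, K j → ∀ i ∈ l, j < i)
    (hT : T.IsSound I s per K) (hN : T.Dominates γ S K N) :
    (Timed.loop (periodStep F I.loc s α τ per) T l).val.IsSound I s per (fun j => K j ∨ j ∈ l) ∧
    (Timed.loop (periodStep F I.loc s α τ per) T l).val.Dominates γ S (fun j => K j ∨ j ∈ l)
      (N + (l.map fun i => (S i).length).sum) := by
  induction l generalizing K T N with
  | nil => simpa using ⟨hT, hN⟩
  | cons i l ih =>
    rw [List.pairwise_cons] at hl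
    have h1 : ∀ j, K j → j < i := fun j hj => hK j hj i (by simp)
    have h := ih (fun j => K j ∨ j = i) (periodStep F I.loc s α τ per T i).val
      (N + (S i).length) hl.2 ?_ (periodStep_isSound hF hs hper hT fun h => lt_irrefl _ (h1 i h))
      (periodStep_dominates hF hs hT hS h1 hN)
    · simpa only [Timed.val_loop_cons, List.mem_cons, or_assoc, List.map_cons, List.sum_cons,
        add_assoc] using h
    · rintro j (hj | rfl) k hk
      · exact hK j hj k (by simp [hk])
      · exact hl.1 k hk

theorem isSchedule_nil (loc : Fin n → V) : IsSchedule loc s α τ per fun _ => [] := by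
  constructor <;> simp

theorem isSound_newTable : (newTable n).val.IsSound I s per fun _ => False := by
  intro v π x hx
  cases hx

theorem val_repairman_fst (F : PathFinder V) (loc : Fin n → V) (s α τ : ℝ)
    (per : Fin n → Option ℤ) : (repairman F loc s α τ per).val.1 = (bestEntry
      (Timed.loop (periodStep F loc s α τ per) (newTable n).val (usedPeriods per).val).val).val.1 :=
  rfl

theorem val_repairman_snd (F : PathFinder V) (loc : Fin n → V) (s α τ : ℝ)
    (per : Fin n → Option ℤ) : (repairman F loc s α τ per).val.2 = partsRun loc s (bestEntry
      (Timed.loop (periodStep F loc s α τ per) (newTable n).val (usedPeriods per).val).val).val.2 := by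
  rw [repairman_eq]
  simp [val_loop_emitPath]

/-- The runs found in the dynamic program are service runs. -/
theorem isValidParts_bestEntry (hF : F.IsApprox γ) (hs : 0 < s)
    (hper : ∀ p i, per p = some i → I.start p ≤ τ + i * α ∧ τ + (i + 1) * α ≤ I.finish p) :
    ∃ K, IsValidParts I s per K
      (bestEntry (Timed.loop (periodStep F I.loc s α τ per) (newTable n).val
        (usedPeriods per).val).val).val.1
      (bestEntry (Timed.loop (periodStep F I.loc s α τ per) (newTable n).val
        (usedPeriods per).val).val).val.2 := by
  -- Soundness does not involve a comparison run, so the empty schedule serves.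
  have h := (loop_periodStep_spec hF hs hper (isSchedule_nil I.loc) (usedPeriods per).val
    (fun _ => False) (newTable n).val 0 (pairwise_usedPeriods per) (fun _ h => h.elim)
    isSound_newTable (Or.inl rfl)).1
  rcases bestEntry_mem (Timed.loop (periodStep F I.loc s α τ per) (newTable n).val
    (usedPeriods per).val).val with h' | ⟨_, v, x, hx, hparts⟩
  · rw [h']
    exact ⟨fun _ => False, IsValidParts.nil _⟩
  · rw [hparts]
    exact ⟨_, (h v _ x hx).1⟩

theorem repairman_isServiceRun (hF : F.IsApprox γ) (hs : 0 < s)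
    (hper : ∀ p i, per p = some i → I.start p ≤ τ + i * α ∧ τ + (i + 1) * α ≤ I.finish p) :
    I.IsServiceRun s (repairman F I.loc s α τ per).val.2 ∧
      (repairman F I.loc s α τ per).val.2.length = (repairman F I.loc s α τ per).val.1 := by
  obtain ⟨K, hK⟩ := isValidParts_bestEntry hF hs hper
  rw [val_repairman_snd, val_repairman_fst]
  exact ⟨hK.1, hK.2⟩

theorem sum_schedule_le_repairman (hF : F.IsApprox γ) (hs : 0 < s)
    (hγ : 0 ≤ γ)
    (hper : ∀ p i, per p = some i → I.start p ≤ τ + i * α ∧ τ + (i + 1) * α ≤ I.finish p)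
    {S : ℤ → List (Fin n × ℝ)} (hS : IsSchedule I.loc s α τ per S) :
    ((((usedPeriods per).val.map fun i => (S i).length).sum : ℕ) : ℝ) ≤
      γ * (repairman F I.loc s α τ per).val.1 := by
  have h := loop_periodStep_spec hF hs hper hS (usedPeriods per).val
    (fun _ => False) (newTable n).val 0 (pairwise_usedPeriods per) (fun _ h => h.elim)
    isSound_newTable (Or.inl rfl)
  rw [val_repairman_fst]
  rcases h.2 with h0 | ⟨v, π, t, ⟨x, hx, _⟩, h2, -⟩
  · rw [zero_add] at h0
    rw [h0]
    push_cast
    positivity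
  · rw [zero_add] at h2
    have hv := (h.1 v π x hx).1
    have hπ : π ≤ n := hv.length_eq ▸ hv.isServiceRun.length_le
    exact h2.trans (mul_le_mul_of_nonneg_left (by exact_mod_cast le_bestEntry hπ hx) hγ)

end Repairman

end

/-! ## The cost of the repairman algorithm -/

section Cost

variable {V : Type*} [MetricSpace V] {n : ℕ}

theorem steps_newTable (n : ℕ) : (newTable n).steps = n * (n + 1) := rfl

theorem steps_usedPeriods_le (per : Fin n → Option ℤ) :
    (usedPeriods per).steps ≤ 1 + n * (n + 2) := by
  have h := Timed.loop_steps_le_of_size (f := insertPeriod per) List.length ?_ ?_ []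
    (List.finRange n)
  · simpa [usedPeriods] using h
  · intro b a
    rw [insertPeriod]
    split
    · simp
    · exact Timed.length_insertSorted_le _ _
  · intro b a
    rw [insertPeriod]
    split
    · simp
    · exact Timed.steps_insertSorted_le _ _

theorem steps_periodRequests_le (per : Fin n → Option ℤ) (i : ℤ) :
    (periodRequests per i).steps ≤ 1 + n * 2 := by
  refine (Timed.loop_steps_le (c := 1) (fun _ _ _ => le_rfl) _).trans ?_
  rw [List.length_finRange]

theorem steps_entryTable_le (loc : Fin n → V) (s a : ℝ) (P : List (Fin n)) (T : RunTable n) :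
    (entryTable loc s a P T).steps ≤
      n * (n + 1) + (1 + P.length * (1 + (1 + (1 + n * (1 + (1 + (n + 1) * (1 + 1))))))) := by
  rw [entryTable_eq, Timed.steps_bind, steps_newTable]
  refine Nat.add_le_add_left (Timed.loop_steps_le (fun E u _ => ?_) _) _
  rw [entryStep, Timed.steps_bind, steps_relax]
  refine Nat.add_le_add_left ?_ _
  refine (Timed.loop_steps_le (c := 1 + (n + 1) * (1 + 1)) (fun E w _ => ?_) _).trans
    (by rw [List.length_finRange])
  refine (Timed.loop_steps_le (c := 1) (fun E π _ => ?_) _).trans (by rw [List.length_range])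
  split <;> simp

theorem steps_extendPath_le (loc : Fin n → V) (s b : ℝ) (E : RunTable n) (u v : Fin n)
    (T : RunTable n) (l : List (Fin n)) :
    (extendPath loc s b E u v T l).steps ≤ l.length + (1 + (n + 1) * (1 + 1)) := by
  cases l with
  | nil => simp only [extendPath, Timed.steps_step]; omega
  | cons p l =>
    rw [extendPath, Timed.steps_bind, steps_measurePath _ _ (by simp)]
    refine Nat.add_le_add_left ?_ _
    refine (Timed.loop_steps_le (c := 1) ?_ _).trans (by rw [List.length_range])
    intro T π _
    split
    · simp
    · split_ifs <;> simp

theorem steps_extendTable_le (loc : Fin n → V) (s b : ℝ) (P : List (Fin n))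
    (paths : Fin n → Fin n → ℕ → List (Fin n)) (E T : RunTable n)
    (h : ∀ u ∈ P, ∀ v ∈ P, ∀ k, (paths u v k).length ≤ P.length) :
    (extendTable loc s b P paths E T).steps ≤
      1 + P.length * (1 + (1 + P.length * (1 + (1 + P.length *
        (1 + (P.length + (1 + (n + 1) * (1 + 1)))))))) := by
  rw [extendTable_eq]
  refine Timed.loop_steps_le (fun T u hu => Timed.loop_steps_le (fun T v hv => ?_) _) _
  refine (Timed.loop_steps_le (c := P.length + (1 + (n + 1) * (1 + 1))) (fun T k _ => ?_) _).trans
    (by rw [List.length_range])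
  exact (steps_extendPath_le loc s b E u v T _).trans
    (Nat.add_le_add_right (h u hu v hv _) _)

theorem steps_bestEntry_le (T : RunTable n) :
    (bestEntry T).steps ≤ 1 + n * (1 + (1 + (n + 1) * (1 + 1))) := by
  refine (Timed.loop_steps_le (c := 1 + (n + 1) * (1 + 1)) (fun B v _ => ?_) _).trans
    (by rw [List.length_finRange])
  refine (Timed.loop_steps_le (c := 1) (fun B π _ => ?_) _).trans (by rw [List.length_range])
  split <;> simp

theorem length_le_sum_length_parts {l : List (ℝ × List (Fin n))} (h : ∀ x ∈ l, x.2 ≠ []) :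
    l.length ≤ (l.map fun x => x.2.length).sum := by
  induction l with
  | nil => simp
  | cons x l ih =>
    have h1 := List.length_pos_iff.2 (h x (by simp))
    have h2 := ih fun y hy => h y (by simp [hy])
    simp only [List.length_cons, List.map_cons, List.sum_cons]
    omega

theorem steps_loop_emitPath_le (loc : Fin n → V) (s : ℝ) (l : List (ℝ × List (Fin n)))
    (h : ∀ x ∈ l, x.2 ≠ []) :
    (Timed.loop (fun R x => emitPath loc s R x.1 x.2) [] l).steps ≤
      1 + 2 * (partsRun loc s l).length := by
  refine (Timed.loop_steps_le_sum (c := fun x => x.2.length)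
    (fun R x hx => (steps_emitPath loc s R x.1 x.2 (h x hx)).le) _).trans ?_
  have h1 := length_le_sum_length_parts h
  rw [List.sum_map_add, ← sum_length_parts]
  simp only [List.map_const', List.sum_replicate, smul_eq_mul, mul_one]
  omega

theorem IsPath.length_le {P : List (Fin n)} {u v : Fin n} {l : List (Fin n)}
    (h : IsPath P u v l) : l.length ≤ P.length :=
  h.1.length_le_of_subset h.2.1

variable {F : PathFinder V} {γ : ℝ} {Γ : ℕ → ℕ}

/-- Apart from the call of `F`, all work is charged to the requests of the period, `O(n ^ 3)` for
each. A used period has at least one request, which also pays for the terms that do not depend on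
their number. -/
theorem steps_periodStep_le (hF : F.IsApprox γ) (hΓ : F.RunsIn Γ) (loc : Fin n → V) (s α τ : ℝ)
    (per : Fin n → Option ℤ) (T : RunTable n) {i : ℤ} (hi : i ∈ (usedPeriods per).val) :
    1 + (periodStep F loc s α τ per T i).steps ≤
      Γ (periodRequests per i).val.length + 40 * (n ^ 3 * (periodRequests per i).val.length) := by
  rw [periodStep, Timed.steps_bind, Timed.steps_bind, Timed.steps_bind]
  set P := (periodRequests per i).val with hP
  have hnd : P.Nodup := nodup_periodRequests per i
  obtain ⟨p, hp⟩ := mem_usedPeriods.1 hi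
  have hpP : p ∈ P := mem_periodRequests.2 hp
  have hne : P ≠ [] := List.ne_nil_of_mem hpP
  have h1 := steps_periodRequests_le per i
  have h2 := hΓ n loc P hne hnd
  have h3 := steps_entryTable_le loc s (τ + i * α) P T
  have h4 := steps_extendTable_le loc s (τ + (i + 1) * α) P (F n loc P).val
    (entryTable loc s (τ + i * α) P T).val T ?_
  · have hk : 1 ≤ P.length := List.length_pos_iff.2 hne
    have hkn : P.length ≤ n := by simpa using hnd.length_le_card
    have hn : 1 ≤ n := hk.trans hkn
    generalize P.length = k at *
    have e1 : 1 ≤ n ^ 3 * k := Nat.mul_pos (by positivity) hk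
    have e2 : n ≤ n ^ 3 * k := by
      calc n = n * 1 * 1 := by ring
        _ ≤ n * n ^ 2 * k := by gcongr; exact Nat.one_le_pow _ _ hn
        _ = n ^ 3 * k := by ring
    have e3 : n ^ 2 ≤ n ^ 3 * k := by
      calc n ^ 2 = n ^ 2 * 1 * 1 := by ring
        _ ≤ n ^ 2 * n * k := by gcongr
        _ = n ^ 3 * k := by ring
    have e4 : k ≤ n ^ 3 * k := by
      calc k = 1 * k := by ring
        _ ≤ n ^ 3 * k := by gcongr; exact Nat.one_le_pow _ _ hn
    have e5 : k * n ≤ n ^ 3 * k := by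
      calc k * n = n * 1 * k := by ring
        _ ≤ n * n ^ 2 * k := by gcongr; exact Nat.one_le_pow _ _ hn
        _ = n ^ 3 * k := by ring
    have e6 : k * n ^ 2 ≤ n ^ 3 * k := by
      calc k * n ^ 2 = n ^ 2 * 1 * k := by ring
        _ ≤ n ^ 2 * n * k := by gcongr
        _ = n ^ 3 * k := by ring
    have e7 : k * k ≤ n ^ 3 * k := (Nat.mul_le_mul_left k hkn).trans e5
    have e8 : k * k * k ≤ n ^ 3 * k := by
      calc k * k * k ≤ n * n * k := by gcongr
        _ = k * n ^ 2 := by ring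
        _ ≤ _ := e6
    have e9 : k * k * k * k ≤ n ^ 3 * k := by
      calc k * k * k * k ≤ n * n * n * k := by gcongr
        _ = n ^ 3 * k := by ring
    have e10 : k * k * k * n ≤ n ^ 3 * k := by
      calc k * k * k * n ≤ n * n * k * n := by gcongr
        _ = n ^ 3 * k := by ring
    nlinarith
  · intro u hu v hv k
    rcases (hF n loc P hnd u hu v hv).1 k with h | h
    · simp [h]
    · exact h.length_le

theorem sum_length_periodRequests_le (per : Fin n → Option ℤ) {l : List ℤ} (hl : l.Nodup) :
    (l.map fun i => (periodRequests per i).val.length).sum ≤ n := by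
  rw [← List.length_flatMap]
  have h : (l.flatMap fun i => (periodRequests per i).val).Nodup := by
    rw [List.nodup_flatMap]
    refine ⟨fun i _ => nodup_periodRequests per i, hl.imp fun {i j} hij p hp hp' => ?_⟩
    rw [mem_periodRequests] at hp hp'
    exact hij (Option.some.inj (hp.symm.trans hp'))
  simpa using h.length_le_card

theorem sum_map_le_of_superadditive (hadd : ∀ a b, Γ a + Γ b ≤ Γ (a + b)) (l : List ℕ) :
    (l.map Γ).sum ≤ Γ l.sum := by
  induction l with
  | nil => exact Nat.zero_le _
  | cons a l ih =>
    simp only [List.map_cons, List.sum_cons]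
    exact (Nat.add_le_add_left ih _).trans (hadd _ _)

theorem monotone_of_superadditive (hadd : ∀ a b, Γ a + Γ b ≤ Γ (a + b)) : Monotone Γ := by
  intro a b h
  obtain ⟨c, rfl⟩ := Nat.exists_eq_add_of_le h
  exact (Nat.le_add_right _ _).trans (hadd a c)

/-- Each request is trimmed to at most one period, so the sizes of the periods sum to at most `n`.
Superadditivity bounds the calls of `F` by `Γ n`, and the remaining charges sum to a multiple of `n
^ 4 ≤ Γ n`. -/
theorem steps_repairman_le (hF : F.IsApprox γ) (hΓ : F.RunsIn Γ) (h4 : ∀ n, n ^ 4 ≤ Γ n)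
    (hadd : ∀ a b, Γ a + Γ b ≤ Γ (a + b)) (hn : 0 < n) (I : RepairInstance V n) {s α τ : ℝ}
    (hs : 0 < s) {per : Fin n → Option ℤ}
    (hper : ∀ p i, per p = some i → I.start p ≤ τ + i * α ∧ τ + (i + 1) * α ≤ I.finish p) :
    (repairman F I.loc s α τ per).steps ≤ 60 * Γ n := by
  obtain ⟨K, hK⟩ := isValidParts_bestEntry hF hs hper
  rw [repairman_eq]
  simp only [Timed.steps_bind, Timed.steps_pure]
  set T := (Timed.loop (periodStep F I.loc s α τ per) (newTable n).val (usedPeriods per).val).val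
  have h1 := steps_usedPeriods_le per
  have h2 := steps_newTable n
  have h3 := steps_bestEntry_le T
  have h5 := steps_loop_emitPath_le I.loc s _ hK.ne_nil
  have h6 : (Timed.loop (periodStep F I.loc s α τ per) (newTable n).val
      (usedPeriods per).val).steps ≤ 1 + (Γ n + 40 * (n ^ 3 * n)) := by
    have hsum : ∀ l : List ℤ, l ⊆ (usedPeriods per).val → ∀ T,
        (Timed.loop (periodStep F I.loc s α τ per) T l).steps ≤
          1 + (l.map fun i => Γ (periodRequests per i).val.length +
            40 * (n ^ 3 * (periodRequests per i).val.length)).sum := by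
      intro l
      induction l with
      | nil => intro _ T; simp
      | cons i l ih =>
        intro hl T
        rw [List.cons_subset] at hl
        have e1 := steps_periodStep_le hF hΓ I.loc s α τ per T hl.1
        have e2 := ih hl.2 (periodStep F I.loc s α τ per T i).val
        simp only [Timed.steps_loop_cons, List.map_cons, List.sum_cons]
        omega
    refine (hsum _ (List.Subset.refl _) _).trans (Nat.add_le_add_left ?_ _)
    have hle := sum_length_periodRequests_le per ((pairwise_usedPeriods per).imp ne_of_lt)
    rw [List.sum_map_add, List.sum_map_mul_left, List.sum_map_mul_left]
    refine Nat.add_le_add ?_ (by gcongr)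
    refine le_trans ?_ (monotone_of_superadditive hadd hle)
    have := sum_map_le_of_superadditive hadd
      ((usedPeriods per).val.map fun i => (periodRequests per i).val.length)
    rwa [List.map_map] at this
  have h7 : (partsRun I.loc s (bestEntry T).val.2).length ≤ n := hK.isServiceRun.length_le
  have h8 := h4 n
  have e1 : 1 ≤ n ^ 4 := Nat.one_le_pow _ _ hn
  have e2 : n ≤ n ^ 4 := Nat.le_self_pow (by norm_num) n
  have e3 : n * n ≤ n ^ 4 := by
    calc n * n = n ^ 2 := by ring
      _ ≤ n ^ 4 := Nat.pow_le_pow_right hn (by norm_num)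
  have e4 : n ^ 3 * n = n ^ 4 := by ring
  rw [e4] at h6
  nlinarith

end Cost

noncomputable section

/-! ## The fast repairman who races back and forth along a slower run -/

/-- The time at which the fast repairman meets the stop at time `t` of the run at unit speed while
in the period with index `i`.  In the period that begins at time `c` he covers the part of the run
between the times `c - x` and `c - x + (s - 1) * α`, forward if `i` is even and backward if `i` is
odd. -/
def raceTime (s α τ x : ℝ) (i : ℤ) (t : ℝ) : ℝ :=
  if Even i then τ + i * α + (t - (τ + i * α - x - α)) / s
  else τ + i * α + (τ + i * α - x + s * α - t) / s

/-- The stop at time `t` is in the part of the run that is covered in the period with index `i`. -/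
def IsRaced (s α τ x : ℝ) (i : ℤ) (t : ℝ) : Prop :=
  τ + i * α - x < t ∧ t < τ + i * α - x + (s - 1) * α

section Race

variable {s α τ x : ℝ} {i j : ℤ} {t t' : ℝ}

/-- Clearing the denominator `s` reduces the estimates on the race to inequalities without division.
-/
theorem mul_raceTime (hs : 0 < s) : s * raceTime s α τ x i t =
    s * (τ + i * α) + if Even i then t - (τ + i * α - x - α) else τ + i * α - x + s * α - t := by
  rw [raceTime]
  split_ifs <;> rw [mul_add, mul_div_cancel₀ _ hs.ne']

theorem raceTime_mem (hs : 1 ≤ s) (hα : 0 < α) (h : IsRaced s α τ x i t) :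
    τ + i * α ≤ raceTime s α τ x i t ∧ raceTime s α τ x i t < τ + (i + 1) * α := by
  have hs0 : 0 < s := by linarith
  have e := mul_raceTime (s := s) (α := α) (τ := τ) (x := x) (i := i) (t := t) hs0
  obtain ⟨h1, h2⟩ := h
  constructor
  · refine le_of_mul_le_mul_left ?_ hs0
    rw [e]
    split_ifs <;> nlinarith
  · refine lt_of_mul_lt_mul_left ?_ hs0.le
    rw [e]
    split_ifs <;> nlinarith

/-- The position along the slow run is a zigzag function of the fast repairman's time with slope at
most `s`. The forward move by `α` at the beginning of each period joins the sweeps of neighbouring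
periods. -/
theorem abs_sub_le_mul_raceTime_sub (hs : 1 ≤ s) (hα : 0 < α) (hij : i < j)
    (h : IsRaced s α τ x i t) (h' : IsRaced s α τ x j t') :
    |t - t'| ≤ s * (raceTime s α τ x j t' - raceTime s α τ x i t) := by
  have hs0 : 0 < s := by linarith
  rw [mul_sub, mul_raceTime hs0, mul_raceTime hs0]
  obtain ⟨h1, h2⟩ := h
  obtain ⟨h3, h4⟩ := h'
  -- Consecutive periods are the tight case; across a whole intermediate period there is slack,
  -- supplied by `h7` and `h8`.
  obtain rfl | h5 : j = i + 1 ∨ i + 2 ≤ j := by omega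
  · push_cast at *
    rw [abs_le]
    by_cases hi : Even i
    · have hi' : ¬ Even (i + 1) := by simp [hi]
      rw [if_pos hi, if_neg hi']
      constructor <;> nlinarith
    · have hi' : Even (i + 1) := by simpa [Int.even_add_one] using hi
      rw [if_neg hi, if_pos hi']
      constructor <;> nlinarith
  · have h6 : (i : ℝ) + 2 ≤ j := by exact_mod_cast h5
    have h7 : 0 ≤ (s - 1) * (((j : ℝ) - i - 2) * α) :=
      mul_nonneg (by linarith) (mul_nonneg (by linarith) hα.le)
    have h8 : 0 ≤ ((j : ℝ) - i - 2) * α := mul_nonneg (by linarith) hα.le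
    rw [abs_le]
    split_ifs <;> constructor <;> nlinarith

theorem raceTime_sub_of_even (hs : 0 < s) (hi : Even i) :
    s * (raceTime s α τ x i t' - raceTime s α τ x i t) = t' - t := by
  rw [mul_sub, mul_raceTime hs, mul_raceTime hs, if_pos hi, if_pos hi]
  ring

theorem raceTime_sub_of_not_even (hs : 0 < s) (hi : ¬ Even i) :
    s * (raceTime s α τ x i t' - raceTime s α τ x i t) = t - t' := by
  rw [mul_sub, mul_raceTime hs, mul_raceTime hs, if_neg hi, if_neg hi]
  ring

end Race

section Schedule

variable {V : Type*} [MetricSpace V] {n : ℕ} {I : RepairInstance V n} {s α τ x : ℝ}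
  {per : Fin n → Option ℤ} {R : List (Fin n × ℝ)}

theorem RepairInstance.IsServiceRun.pairwise (h : I.IsServiceRun s R) :
    R.Pairwise fun x y => dist (I.loc x.1) (I.loc y.1) ≤ s * (y.2 - x.2) := by
  have : IsTrans (Fin n × ℝ) fun x y => dist (I.loc x.1) (I.loc y.1) ≤ s * (y.2 - x.2) := by
    refine ⟨fun x y z hxy hyz => ?_⟩
    have := dist_triangle (I.loc x.1) (I.loc y.1) (I.loc z.1)
    linarith
  exact List.isChain_iff_pairwise.1 h.2.2

/-- The absolute value makes the bound symmetric, as needed when the race meets stops in an order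
different from that of `R`. -/
theorem dist_le_abs_of_mem (h : I.IsServiceRun 1 R) {y z : Fin n × ℝ} (hy : y ∈ R)
    (hz : z ∈ R) : dist (I.loc y.1) (I.loc z.1) ≤ |y.2 - z.2| := by
  have hsymm : Std.Symm fun y z : Fin n × ℝ => dist (I.loc y.1) (I.loc z.1) ≤ |y.2 - z.2| :=
    ⟨fun y z h => by rwa [dist_comm, abs_sub_comm]⟩
  have h' : R.Pairwise fun y z => dist (I.loc y.1) (I.loc z.1) ≤ |y.2 - z.2| :=
    h.pairwise.imp fun {y z} hyz => by
      rw [abs_sub_comm]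
      exact hyz.trans (by rw [one_mul]; exact le_abs_self _)
  exact h'.forall_of_forall (by simp) hy hz

open Classical in
/-- The stops of `R` that are serviced by the fast repairman in the period with index `i`. -/
def racedStops (s α τ x : ℝ) (per : Fin n → Option ℤ) (R : List (Fin n × ℝ)) (i : ℤ) :
    List (Fin n × ℝ) :=
  R.filter fun z => per z.1 = some i ∧ IsRaced s α τ x i z.2

theorem mem_racedStops {i : ℤ} {z : Fin n × ℝ} : z ∈ racedStops s α τ x per R i ↔
    z ∈ R ∧ per z.1 = some i ∧ IsRaced s α τ x i z.2 := by
  simp [racedStops]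

/-- The run of the fast repairman in the period with index `i`. -/
def raceSchedule (s α τ x : ℝ) (per : Fin n → Option ℤ) (R : List (Fin n × ℝ)) (i : ℤ) :
    List (Fin n × ℝ) :=
  (if Even i then racedStops s α τ x per R i else (racedStops s α τ x per R i).reverse).map
    fun z => (z.1, raceTime s α τ x i z.2)

theorem mem_raceSchedule {i : ℤ} {z : Fin n × ℝ} : z ∈ raceSchedule s α τ x per R i ↔
    ∃ y ∈ racedStops s α τ x per R i, (y.1, raceTime s α τ x i y.2) = z := by
  rw [raceSchedule, List.mem_map]
  split_ifs <;> simp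

theorem length_raceSchedule (i : ℤ) : (raceSchedule s α τ x per R i).length =
    (racedStops s α τ x per R i).length := by
  rw [raceSchedule]
  split_ifs <;> simp

/-- At unit speed, distances are bounded by time differences along `R`, and the race is fast enough
to cover those. The order of the stops is reversed in odd periods, which are swept backward. -/
theorem isSchedule_raceSchedule (hs : 1 ≤ s) (hα : 0 < α) (hR : I.IsServiceRun 1 R) :
    IsSchedule I.loc s α τ per (raceSchedule s α τ x per R) := by
  have hs0 : 0 < s := by linarith
  refine ⟨fun i => ?_, fun i z hz => ?_, fun i z hz => ?_, fun i => ?_, fun i j hij y hy z hz => ?_⟩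
  · rw [raceSchedule, List.map_map]
    have h : ((racedStops s α τ x per R i).map Prod.fst).Nodup :=
      hR.1.sublist (List.Sublist.map _ List.filter_sublist)
    change (List.map Prod.fst _).Nodup
    split_ifs
    · exact h
    · rw [List.map_reverse, List.nodup_reverse]
      exact h
  · obtain ⟨y, hy, rfl⟩ := mem_raceSchedule.1 hz
    exact (mem_racedStops.1 hy).2.1
  · obtain ⟨y, hy, rfl⟩ := mem_raceSchedule.1 hz
    exact raceTime_mem hs hα (mem_racedStops.1 hy).2.2
  · have h : (racedStops s α τ x per R i).Pairwise
        fun x y => dist (I.loc x.1) (I.loc y.1) ≤ 1 * (y.2 - x.2) :=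
      hR.pairwise.sublist List.filter_sublist
    refine List.Pairwise.isChain ?_
    rw [raceSchedule, List.pairwise_map]
    split_ifs with hi
    · refine h.imp fun {y z} hyz => ?_
      rw [raceTime_sub_of_even hs0 hi]
      linarith
    · rw [List.pairwise_reverse]
      refine h.imp fun {y z} hyz => ?_
      rw [raceTime_sub_of_not_even hs0 hi, dist_comm]
      linarith
  · obtain ⟨y, hy', rfl⟩ := mem_raceSchedule.1 hy
    obtain ⟨z, hz', rfl⟩ := mem_raceSchedule.1 hz
    rw [mem_racedStops] at hy' hz'
    exact (dist_le_abs_of_mem hR hy'.1 hz'.1).trans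
      (abs_sub_le_mul_raceTime_sub hs hα hij hy'.2.2 hz'.2.2)

variable {F : PathFinder V} {γ : ℝ}

/-- The repairman algorithm finds a run whose profit is at least `1 / γ` times the number of stops
of a run at unit speed that a fast repairman can service during the trimmed windows. -/
theorem countP_raced_le_repairman (hF : F.IsApprox γ) (hγ : 0 ≤ γ) (hs : 1 ≤ s) (hα : 0 < α)
    (hper : ∀ p i, per p = some i → I.start p ≤ τ + i * α ∧ τ + (i + 1) * α ≤ I.finish p)
    (hR : I.IsServiceRun 1 R) (x : ℝ) (p : Fin n × ℝ → Prop) [DecidablePred p]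
    (hp : ∀ z, p z → ∃ i, per z.1 = some i ∧ IsRaced s α τ x i z.2) :
    ((R.countP fun z => p z : ℕ) : ℝ) ≤ γ * (repairman F I.loc s α τ per).val.1 := by
  refine le_trans ?_ (sum_schedule_le_repairman hF (by linarith) hγ hper
    (isSchedule_raceSchedule (x := x) hs hα hR))
  rw [Nat.cast_le, List.countP_eq_length_filter]
  simp only [length_raceSchedule]
  rw [← List.length_flatMap]
  refine List.Nodup.length_le_of_subset (hR.1.of_map.filter _) fun z hz => ?_
  simp only [List.mem_filter, decide_eq_true_eq] at hz
  obtain ⟨i, hi, hir⟩ := hp z hz.2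
  rw [List.mem_flatMap]
  exact ⟨i, mem_usedPeriods.2 ⟨_, hi⟩, mem_racedStops.2 ⟨hz.1, hi, hir⟩⟩

end Schedule

end

/-! ## Trimmed windows -/

section Windows

/-- The stretches of the race are open intervals, so they are shifted by a small `ε`. With finitely
many requests, one `ε` respects all strict inequalities between window ends and period boundaries.
-/
theorem exists_pos_add_le {n : ℕ} (f g : Fin n → ℝ) :
    ∃ ε : ℝ, 0 < ε ∧ ∀ ε' ≤ ε, ∀ p, f p < g p → f p + ε' ≤ g p := by
  induction n with
  | zero => exact ⟨1, one_pos, fun _ _ p => p.elim0⟩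
  | succ n ih =>
    obtain ⟨ε, hε, h⟩ := ih (fun p => f p.succ) fun p => g p.succ
    by_cases h0 : f 0 < g 0
    · refine ⟨min ε (g 0 - f 0), lt_min hε (sub_pos.2 h0), fun ε' hε' p => ?_⟩
      refine Fin.cases (fun _ => ?_) (fun p => ?_) p
      · have := hε'.trans (min_le_right _ _)
        linarith
      · exact h ε' (hε'.trans (min_le_left _ _)) p
    · refine ⟨ε, hε, fun ε' hε' p => ?_⟩
      refine Fin.cases (fun h1 => absurd h1 h0) (fun p => ?_) p
      exact h ε' hε' p

theorem trimIndex_spec {α τ a b : ℝ} (hα : 0 < α) {j k : ℕ} (hj : 1 ≤ j ∧ j ≤ 2)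
    (hk : 1 ≤ k ∧ k ≤ 3) {i : ℤ} (h : trimIndex α τ j k a b = some i) :
    a ≤ τ + i * α ∧ τ + (i + 1) * α ≤ b := by
  have key : ⌊(a - τ) / α⌋ + 1 ≤ i ∧ i + 1 ≤ ⌊(b - τ) / α⌋ := by
    simp only [trimIndex] at h
    split_ifs at h <;> simp only [Option.some.injEq] at h <;> omega
  have h1 : (a - τ) / α < i := by
    refine (Int.lt_floor_add_one _).trans_le ?_
    exact_mod_cast key.1
  have h2 : ((i : ℝ) + 1) ≤ (b - τ) / α := by
    have := Int.le_floor.1 key.2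
    push_cast at this
    exact this
  rw [div_lt_iff₀ hα] at h1
  rw [le_div_iff₀ hα] at h2
  constructor <;> linarith

/-- The window starts strictly before the three half-unit periods that it fills. Conversely, a
window of length at most `3 / 2` leaves only two possible indices for filled periods. -/
theorem lt_sub_of_inW_three {τ a b : ℝ} (h : InW 3 (1 / 2) τ a b) : 3 / 2 < b - a := by
  by_contra hab
  have hsub : fullPeriods (1 / 2) τ a b ⊆ {⌊(a - τ) / (1 / 2)⌋ + 1, ⌊(a - τ) / (1 / 2)⌋ + 2} := by
    rintro i ⟨h1, h2⟩
    have h3 : ⌊(a - τ) / (1 / 2)⌋ < i := by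
      rw [Int.floor_lt, div_lt_iff₀ (by norm_num)]
      linarith
    have h4 : (i : ℝ) < ((⌊(a - τ) / (1 / 2)⌋ + 3 : ℤ) : ℝ) := by
      have := Int.lt_floor_add_one ((a - τ) / (1 / 2))
      rw [div_lt_iff₀ (by norm_num)] at this
      push_cast
      linarith
    have h5 : i < ⌊(a - τ) / (1 / 2)⌋ + 3 := by exact_mod_cast h4
    simp only [Set.mem_insert_iff, Set.mem_singleton_iff]
    omega
  have h1 := Set.ncard_le_ncard hsub (Set.toFinite _)
  have h2 := Set.ncard_insert_le (⌊(a - τ) / (1 / 2)⌋ + 1) {⌊(a - τ) / (1 / 2)⌋ + 2}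
  rw [Set.ncard_singleton] at h2
  rw [InW] at h
  omega

/-- The beginning of the first period of length `3 / 4` that is filled by a window that starts at
time `a`. -/
noncomputable def firstStart (τ a : ℝ) : ℝ :=
  τ + ((⌊(a - τ) / (3 / 4)⌋ + 1 : ℤ) : ℝ) * (3 / 4)

theorem lt_firstStart (τ a : ℝ) : a < firstStart τ a := by
  have := Int.lt_floor_add_one ((a - τ) / (3 / 4))
  rw [div_lt_iff₀ (by norm_num)] at this
  rw [firstStart]
  push_cast
  linarith

theorem firstStart_le (τ a : ℝ) : firstStart τ a ≤ a + 3 / 4 := by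
  have := Int.floor_le ((a - τ) / (3 / 4))
  rw [le_div_iff₀ (by norm_num)] at this
  rw [firstStart]
  push_cast
  linarith

/-- Windows of length between `3 / 2` and `2` fill one or two periods of length `3 / 4`. -/
theorem trimIndex_three_quarters {τ a b : ℝ} (h : 3 / 2 < b - a) (h' : b - a ≤ 2) :
    (b < firstStart τ a + 3 / 2 ∧
      ∀ j, trimIndex (3 / 4) τ j 1 a b = some (⌊(a - τ) / (3 / 4)⌋ + 1)) ∨
    (firstStart τ a + 3 / 2 ≤ b ∧
      ∀ j : ℕ, trimIndex (3 / 4) τ j 1 a b = some (⌊(a - τ) / (3 / 4)⌋ + 1 + ((j : ℤ) - 1))) := by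
  have h1 := lt_firstStart τ a
  have h2 := firstStart_le τ a
  have h3 := Int.floor_le ((b - τ) / (3 / 4))
  have h4 := Int.lt_floor_add_one ((b - τ) / (3 / 4))
  rw [le_div_iff₀ (by norm_num)] at h3
  rw [div_lt_iff₀ (by norm_num)] at h4
  rw [firstStart] at *
  simp only [trimIndex]
  generalize ⌊(a - τ) / (3 / 4)⌋ + 1 = f at *
  generalize ⌊(b - τ) / (3 / 4)⌋ = g at *
  -- The first period begins after `a` and by `a + 3 / 4`, while `b` lies between `a + 3 / 2` and `a
  -- + 2`; this leaves room for one or two filled periods.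
  have h5 : g < f + 3 := by
    have : (g : ℝ) < ((f + 3 : ℤ) : ℝ) := by push_cast; linarith
    exact_mod_cast this
  have h6 : f < g := by
    have : (f : ℝ) < (g : ℝ) := by linarith
    exact_mod_cast this
  obtain rfl | rfl : g = f + 1 ∨ g = f + 2 := by omega
  · left
    push_cast at h4
    refine ⟨by linarith, fun j => ?_⟩
    simp
  · right
    push_cast at h3
    refine ⟨by linarith, fun j => ?_⟩
    simp

/-- One of three sets of periods has the first filled period more than `1 / 2` after the start of
the window. -/
theorem exists_half_lt_floor (a : ℝ) : ∃ q : Fin 3,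
    a + 1 / 2 < (q : ℕ) / 4 + ((⌊(a - (q : ℕ) / 4) / (3 / 4)⌋ + 1 : ℤ) : ℝ) * (3 / 4) := by
  have h1 := Int.floor_le (a / (3 / 4))
  have h2 := Int.lt_floor_add_one (a / (3 / 4))
  rw [le_div_iff₀ (by norm_num)] at h1
  rw [div_lt_iff₀ (by norm_num)] at h2
  -- If `a` lies in the quarter-unit interval number `q` of its period, then the period of the grid
  -- shifted by `q / 4` that contains `a` began less than `1 / 4` before `a`. The next one begins
  -- more than `1 / 2` after `a`.
  have key : ∀ q : Fin 3, (⌊a / (3 / 4)⌋ : ℝ) * (3 / 4) + (q : ℕ) / 4 ≤ a →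
      a < (⌊a / (3 / 4)⌋ : ℝ) * (3 / 4) + (q : ℕ) / 4 + 1 / 4 →
      a + 1 / 2 < (q : ℕ) / 4 + ((⌊(a - (q : ℕ) / 4) / (3 / 4)⌋ + 1 : ℤ) : ℝ) * (3 / 4) := by
    intro q h3 h4
    have : ⌊a / (3 / 4)⌋ ≤ ⌊(a - (q : ℕ) / 4) / (3 / 4)⌋ := by
      rw [Int.le_floor, le_div_iff₀ (by norm_num)]
      linarith
    have h5 : (⌊a / (3 / 4)⌋ : ℝ) ≤ (⌊(a - (q : ℕ) / 4) / (3 / 4)⌋ : ℝ) := by exact_mod_cast this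
    push_cast
    linarith
  rcases lt_or_ge a ((⌊a / (3 / 4)⌋ : ℝ) * (3 / 4) + 1 / 4) with h3 | h3
  · exact ⟨0, key 0 (by simpa using h1) (by simpa using h3)⟩
  rcases lt_or_ge a ((⌊a / (3 / 4)⌋ : ℝ) * (3 / 4) + 1 / 2) with h4 | h4
  · exact ⟨1, key 1 (by norm_num; linarith) (by norm_num; linarith)⟩
  · exact ⟨2, key 2 (by norm_num; linarith) (by norm_num; linarith)⟩

/-! ### Stops covered by the race with periods of length `3 / 4` -/

variable {s τ ε a b t : ℝ}

theorem isRaced_three_quarters_iff {i : ℤ} : IsRaced s (3 / 4) τ (3 / 4 + ε) i t ↔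
    τ + i * (3 / 4) - (3 / 4 + ε) < t ∧ t < τ + i * (3 / 4) - (3 / 4 + ε) + (s - 1) * (3 / 4) :=
  Iff.rfl

/-- At speed `14 / 3` everything is covered. -/
theorem isRaced_of_le (hs : 14 / 3 ≤ s) (hε : 0 < ε) (h : 3 / 2 < b - a) (h' : b - a ≤ 2)
    (ha : a + ε ≤ firstStart τ a) (hta : a ≤ t) (htb : t < b) :
    ∃ i, trimIndex (3 / 4) τ 1 1 a b = some i ∧ IsRaced s (3 / 4) τ (3 / 4 + ε) i t := by
  have h1 := firstStart_le τ a
  refine ⟨⌊(a - τ) / (3 / 4)⌋ + 1, ?_, ?_⟩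
  · rcases trimIndex_three_quarters (τ := τ) h h' with h2 | h2
    · exact h2.2 1
    · simpa using h2.2 1
  · rw [isRaced_three_quarters_iff]
    rw [firstStart] at *
    constructor <;> linarith

/-- At speed `4` everything in the windows that fill one period is covered. -/
theorem isRaced_of_lt_firstStart (hs : 4 ≤ s) (hε : 0 < ε) (h : 3 / 2 < b - a) (h' : b - a ≤ 2)
    (hb : b < firstStart τ a + 3 / 2) (hbε : b + ε ≤ firstStart τ a + 3 / 2)
    (hta : a ≤ t) (htb : t < b) (j : ℕ) :
    ∃ i, trimIndex (3 / 4) τ j 1 a b = some i ∧ IsRaced s (3 / 4) τ (3 / 4 + ε) i t := by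
  have h1 := firstStart_le τ a
  refine ⟨⌊(a - τ) / (3 / 4)⌋ + 1, ?_, ?_⟩
  · rcases trimIndex_three_quarters (τ := τ) h h' with h2 | h2
    · exact h2.2 j
    · exact absurd hb (not_lt.2 h2.1)
  · rw [isRaced_three_quarters_iff]
    rw [firstStart] at *
    constructor <;> linarith

/-- At speed `4` everything is covered for one of the two ways to trim windows. -/
theorem isRaced_or_isRaced (hs : 4 ≤ s) (hε : 0 < ε) (hε4 : ε ≤ 1 / 4) (h : 3 / 2 < b - a)
    (h' : b - a ≤ 2) (hbε : b < firstStart τ a + 3 / 2 → b + ε ≤ firstStart τ a + 3 / 2)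
    (hta : a ≤ t) (htb : t < b) :
    (∃ i, trimIndex (3 / 4) τ 1 1 a b = some i ∧ IsRaced s (3 / 4) τ (3 / 4 + ε) i t) ∨
    ∃ i, trimIndex (3 / 4) τ 2 1 a b = some i ∧ IsRaced s (3 / 4) τ (3 / 4 + ε) i t := by
  rcases trimIndex_three_quarters (τ := τ) h h' with h2 | h2
  · exact Or.inl (isRaced_of_lt_firstStart hs hε h h' h2.1 (hbε h2.1) hta htb 1)
  · have h1 := firstStart_le τ a
    have h3 := lt_firstStart τ a
    -- The threshold is the left end of the stretch of the second filled period. That stretch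
    -- reaches at least `9 / 4 - ε` beyond the first start, which is past `b` because `ε ≤ 1 / 4`.
    rcases le_or_gt t (firstStart τ a - ε) with ht | ht
    · left
      refine ⟨_, h2.2 1, ?_⟩
      rw [isRaced_three_quarters_iff]
      rw [firstStart] at *
      push_cast at *
      constructor <;> linarith
    · right
      refine ⟨_, h2.2 2, ?_⟩
      rw [isRaced_three_quarters_iff]
      rw [firstStart] at *
      push_cast at *
      constructor <;> linarith

end Windows

-- Double counting of the pairs of a trial and a stop covered in it.
open Classical in
theorem mul_length_le_sum_countP {ι β : Type*} [Fintype ι] (p : ι → β → Prop) (c : ℕ) (R : List β)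
    (h : ∀ z ∈ R, c ≤ ∑ k, if p k z then 1 else 0) :
    c * R.length ≤ ∑ k, R.countP fun z => p k z := by
  induction R with
  | nil => simp
  | cons z R ih =>
    have h1 := ih fun y hy => h y (by simp [hy])
    have h2 := h z (by simp)
    simp only [List.countP_cons, Finset.sum_add_distrib, List.length_cons, decide_eq_true_eq]
    rw [mul_add, mul_one]
    exact Nat.add_le_add h1 h2

noncomputable section

/-! ## The subroutine SPEEDUP -/

section Speedup

variable {V : Type*} {n : ℕ} {I : RepairInstance V n} {s : ℝ} {r : ℕ∞} {α τ₀ : ℝ}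
  {j k : ℕ} {F : PathFinder V} {γ : ℝ} {Γ : ℕ → ℕ}

theorem val_better {β : Type} (x y : ℕ × β) :
    (better x y).val = if x.1 < y.1 then y else x := rfl

theorem le_better_left {β : Type} (x y : ℕ × β) : x.1 ≤ (better x y).val.1 := by
  rw [val_better]
  split_ifs with h
  · exact h.le
  · exact le_rfl

theorem le_better_right {β : Type} (x y : ℕ × β) : y.1 ≤ (better x y).val.1 := by
  rw [val_better]
  split_ifs with h
  · exact le_rfl
  · exact not_lt.1 h

/-- The starting points, relative to `τ₀`, of the periods that begin at window starts. -/
def criticalOffsets (I : RepairInstance V n) (α τ₀ : ℝ) : List ℝ :=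
  (Timed.distinctSorted
    ((List.finRange n).map fun p => Int.fract ((I.start p - τ₀) / α) * α)).val

/-- The distances by which the subroutine SPEEDUP moves the periods. -/
def speedupOffsets (I : RepairInstance V n) (r : ℕ∞) (α τ₀ : ℝ) : List ℝ :=
  if r ≤ ((criticalOffsets I α τ₀).length : ℕ∞) then
    (List.range r.toNat).map fun i : ℕ => (i : ℝ) * α / (r.toNat : ℝ)
  else criticalOffsets I α τ₀

theorem length_criticalOffsets_le (I : RepairInstance V n) (α τ₀ : ℝ) :
    (criticalOffsets I α τ₀).length ≤ n := by
  rw [criticalOffsets, Timed.length_distinctSorted]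
  exact (List.toFinset_card_le _).trans (by simp)

theorem trimIndex_per (hα : 0 < α) (hj : 1 ≤ j ∧ j ≤ 2) (hk : 1 ≤ k ∧ k ≤ 3) (τ : ℝ) (p : Fin n)
    (i : ℤ) (h : trimIndex α τ j k (I.start p) (I.finish p) = some i) :
    I.start p ≤ τ + i * α ∧ τ + (i + 1) * α ≤ I.finish p :=
  trimIndex_spec hα hj hk h

theorem length_speedupOffsets_le (I : RepairInstance V n) (r : ℕ∞) (α τ₀ : ℝ) :
    ((speedupOffsets I r α τ₀).length : ℕ∞) ≤ min r ((criticalOffsets I α τ₀).length : ℕ∞) := by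
  rw [speedupOffsets]
  split_ifs with h
  · have hr : (r.toNat : ℕ∞) = r := ENat.natCast_toNat (ne_top_of_le_ne_top (ENat.natCast_ne_top _) h)
    rw [List.length_map, List.length_range, hr]
    exact le_min le_rfl h
  · exact le_min (not_le.1 h).le le_rfl

/-- If `6` is a multiple of `2 * α`, then the residue of a window start modulo `α` is determined by
that modulo `1 / 2` up to six possibilities. -/
theorem length_criticalOffsets_le_numPeriodSets (I : RepairInstance V n) (hα : 0 < α) {c : ℤ}
    (hc : 6 / (2 * α) = c) :
    (criticalOffsets I α τ₀).length ≤ 6 * I.numPeriodSets (1 / 2) := by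
  classical
  rw [criticalOffsets, Timed.length_distinctSorted]
  let g : ℝ × ℕ → ℝ := fun x => Int.fract (((x.1 + x.2) / 2 - τ₀) / α) * α
  have hsub : ((List.finRange n).map fun p => Int.fract ((I.start p - τ₀) / α) * α).toFinset ⊆
      ((Finset.univ.image fun p => Int.fract (I.start p / (1 / 2))) ×ˢ Finset.range 6).image g := by
    intro y hy
    rw [List.mem_toFinset, List.mem_map] at hy
    obtain ⟨p, -, rfl⟩ := hy
    rw [Finset.mem_image]
    set z := ⌊I.start p / (1 / 2)⌋ with hz
    have hz6 : ((z % 6).toNat : ℤ) = z % 6 := Int.toNat_of_nonneg (Int.emod_nonneg _ (by norm_num))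
    refine ⟨(Int.fract (I.start p / (1 / 2)), (z % 6).toNat), ?_, ?_⟩
    · rw [Finset.mem_product]
      refine ⟨Finset.mem_image_of_mem _ (Finset.mem_univ p), ?_⟩
      rw [Finset.mem_range]
      have := Int.emod_lt_of_pos z (by norm_num : (0 : ℤ) < 6)
      omega
    · have h1 : I.start p = (Int.fract (I.start p / (1 / 2)) + z) / 2 := by
        have := Int.fract_add_floor (I.start p / (1 / 2))
        rw [← hz] at this
        rw [this]
        ring
      have h2 : (z : ℝ) = ((z % 6).toNat : ℝ) + 6 * ((z / 6 : ℤ) : ℝ) := by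
        have h3 : z = ((z % 6).toNat : ℤ) + 6 * (z / 6) := by omega
        exact_mod_cast h3
      -- Replacing `z` by its residue modulo `6` moves the window start by a multiple of `3`, which
      -- is a whole number of periods because `c = 3 / α`.
      have h4 : (I.start p - τ₀) / α =
          ((Int.fract (I.start p / (1 / 2)) + ((z % 6).toNat : ℝ)) / 2 - τ₀) / α +
            ((c * (z / 6) : ℤ) : ℝ) := by
        push_cast
        rw [← hc]
        conv_lhs => rw [h1, h2]
        field_simp
        ring
      simp only [g]
      rw [h4, Int.fract_add_intCast]
  refine (Finset.card_le_card hsub).trans (Finset.card_image_le.trans ?_)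
  rw [Finset.card_product, Finset.card_range, mul_comm]
  rfl

/-- The periods are moved, among others, by a distance for which no division passes a window
start. -/
theorem exists_speedupOffset (hn : 0 < n) (hr : r ≠ 0) (hα : 0 < α) :
    ∃ δ ∈ speedupOffsets I r α τ₀, 0 ≤ δ ∧
      ∀ p, ⌊(I.start p - (τ₀ + δ)) / α⌋ = ⌊(I.start p - τ₀) / α⌋ := by
  rw [speedupOffsets]
  split_ifs with h
  · refine ⟨0, ?_, le_rfl, by simp⟩
    rw [List.mem_map]
    refine ⟨0, ?_, by simp⟩
    rw [List.mem_range, Nat.pos_iff_ne_zero, Ne, ENat.toNat_eq_zero, not_or]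
    exact ⟨hr, ne_top_of_le_ne_top (ENat.natCast_ne_top _) h⟩
  -- The smallest residue moves the periods until a division first meets a window start. Such a
  -- window counts as starting just after the division, so no floor changes.
  · obtain ⟨p₀, -, hp₀⟩ := Finset.exists_min_image Finset.univ
      (fun p => Int.fract ((I.start p - τ₀) / α)) ⟨(⟨0, hn⟩ : Fin n), Finset.mem_univ _⟩
    refine ⟨Int.fract ((I.start p₀ - τ₀) / α) * α, ?_,
      mul_nonneg (Int.fract_nonneg _) hα.le, fun p => ?_⟩
    · rw [criticalOffsets, Timed.mem_distinctSorted]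
      exact List.mem_map.2 ⟨p₀, List.mem_finRange _, rfl⟩
    · have h1 : (I.start p - (τ₀ + Int.fract ((I.start p₀ - τ₀) / α) * α)) / α =
          (I.start p - τ₀) / α - Int.fract ((I.start p₀ - τ₀) / α) := by
        field_simp
        ring
      have h2 := hp₀ p (Finset.mem_univ _)
      have h3 := Int.fract_lt_one ((I.start p - τ₀) / α)
      have h4 := Int.fract_nonneg ((I.start p₀ - τ₀) / α)
      have h5 := Int.floor_add_fract ((I.start p - τ₀) / α)
      rw [h1, Int.floor_eq_iff]
      constructor <;> linarith

variable [MetricSpace V]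

/-- A service run together with its profit. -/
def RepairInstance.IsRunWithProfit (I : RepairInstance V n) (s : ℝ)
    (B : ℕ × List (Fin n × ℝ)) : Prop :=
  I.IsServiceRun s B.2 ∧ B.2.length = B.1

theorem isRunWithProfit_nil : I.IsRunWithProfit s (0, []) :=
  ⟨⟨List.nodup_nil, by simp, List.IsChain.nil⟩, rfl⟩

theorem isRunWithProfit_better {x y : ℕ × List (Fin n × ℝ)} (hx : I.IsRunWithProfit s x)
    (hy : I.IsRunWithProfit s y) : I.IsRunWithProfit s (better x y).val := by
  rw [val_better]
  split_ifs
  · exact hy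
  · exact hx

/-- The work of the subroutine SPEEDUP for one set of periods. -/
def speedupStep (F : PathFinder V) (I : RepairInstance V n) (s α τ₀ : ℝ) (j k : ℕ)
    (best : ℕ × List (Fin n × ℝ)) (δ : ℝ) : Timed (ℕ × List (Fin n × ℝ)) := do
  let per ← Timed.tabulate (fun p => trimIndex α (τ₀ + δ) j k (I.start p) (I.finish p))
  let R ← repairman F I.loc s α (τ₀ + δ) per
  better best R

theorem val_loop_count {β : Type} (l : List β) (m : ℕ∞) :
    (Timed.loop (fun m _ => Timed.step (m + 1)) m l).val = m + (l.length : ℕ∞) := by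
  induction l generalizing m with
  | nil => simp
  | cons a l ih => simp [ih, add_comm, add_left_comm]

theorem val_speedup (F : PathFinder V) (I : RepairInstance V n) (s : ℝ) (r : ℕ∞) (α τ₀ : ℝ)
    (j k : ℕ) : (speedup F I s r α τ₀ j k).val =
      (Timed.loop (speedupStep F I s α τ₀ j k) (0, []) (speedupOffsets I r α τ₀)).val := by
  rw [speedup]
  simp only [Timed.val_bind, Timed.val_mapList, val_loop_count, zero_add]
  rw [speedupOffsets, ← criticalOffsets]
  split_ifs <;> simp <;> rfl

theorem steps_speedup_le {c : ℕ}
    (hc : ∀ B δ, (speedupStep F I s α τ₀ j k B δ).steps ≤ c) :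
    (speedup F I s r α τ₀ j k).steps ≤
      n * n + 6 * n + 5 + (speedupOffsets I r α τ₀).length * (1 + c) := by
  have hlen := length_criticalOffsets_le I α τ₀
  have h2 := Timed.steps_distinctSorted_le
    ((List.finRange n).map fun p => Int.fract ((I.start p - τ₀) / α) * α)
  have h3 := Timed.loop_steps_le (c := 1) (f := fun (m : ℕ∞) (_ : ℝ) => Timed.step (m + 1))
    (l := criticalOffsets I α τ₀) (fun _ _ _ => le_rfl) 0
  have h4 := Timed.loop_steps_le (l := speedupOffsets I r α τ₀) (fun B δ _ => hc B δ) (0, [])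
  rw [speedup]
  simp only [Timed.steps_bind, Timed.val_mapList, val_loop_count, zero_add, Timed.steps_mapList]
  rw [← criticalOffsets]
  simp only [List.length_map, List.length_finRange] at h2 ⊢
  rw [speedupOffsets] at h4 ⊢
  split_ifs at h4 ⊢ with hr
  · have hr' : r.toNat ≤ (criticalOffsets I α τ₀).length := ENat.toNat_le_of_le_natCast hr
    simp only [Timed.steps_bind, Timed.val_mapList, Timed.steps_mapList, List.length_range]
    change _ + (_ + (_ + (_ + (Timed.loop (speedupStep F I s α τ₀ j k) _ _).steps))) ≤ _
    nlinarith
  · simp only [Timed.steps_bind, Timed.val_step, Timed.steps_step]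
    change _ + (_ + (_ + (_ + (Timed.loop (speedupStep F I s α τ₀ j k) _ _).steps))) ≤ _
    nlinarith

theorem isRunWithProfit_speedup (hF : F.IsApprox γ) (hs : 0 < s) (hα : 0 < α)
    (hj : 1 ≤ j ∧ j ≤ 2) (hk : 1 ≤ k ∧ k ≤ 3) :
    I.IsRunWithProfit s (speedup F I s r α τ₀ j k).val := by
  rw [val_speedup]
  refine Timed.loop_invariant (p := I.IsRunWithProfit s) isRunWithProfit_nil fun B δ _ hB => ?_
  exact isRunWithProfit_better hB (repairman_isServiceRun hF hs (trimIndex_per hα hj hk _))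

theorem repairman_le_speedup {δ : ℝ} (hδ : δ ∈ speedupOffsets I r α τ₀) :
    (repairman F I.loc s α (τ₀ + δ) fun p =>
      trimIndex α (τ₀ + δ) j k (I.start p) (I.finish p)).val.1 ≤
        (speedup F I s r α τ₀ j k).val.1 := by
  rw [val_speedup]
  exact Timed.loop_establishes (p := fun _ => True) (q := fun B : ℕ × List (Fin n × ℝ) => _ ≤ B.1)
    hδ trivial (fun _ _ _ _ => trivial) (fun B _ => le_better_right _ _)
    fun B δ _ hB => hB.trans (le_better_left _ _)

theorem steps_speedupStep_le (hF : F.IsApprox γ) (hΓ : F.RunsIn Γ) (h4 : ∀ n, n ^ 4 ≤ Γ n)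
    (hadd : ∀ a b, Γ a + Γ b ≤ Γ (a + b)) (hn : 0 < n) (hs : 0 < s) (hα : 0 < α)
    (hj : 1 ≤ j ∧ j ≤ 2) (hk : 1 ≤ k ∧ k ≤ 3) (B : ℕ × List (Fin n × ℝ)) (δ : ℝ) :
    (speedupStep F I s α τ₀ j k B δ).steps ≤ n + 2 + 60 * Γ n := by
  have := steps_repairman_le hF hΓ h4 hadd hn I hs (trimIndex_per (I := I) hα hj hk (τ₀ + δ))
  rw [speedupStep]
  simp only [Timed.steps_bind, Timed.steps_tabulate, Timed.val_tabulate]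
  change _ + (_ + 1) ≤ _
  omega

end Speedup

end

noncomputable section

/-! ## The algorithm SPEEDUPW12 -/

theorem numPeriodSets_pos {V : Type*} {n : ℕ} (hn : 0 < n) (I : RepairInstance V n) (α : ℝ) :
    0 < I.numPeriodSets α :=
  Finset.card_pos.2 (Finset.image_nonempty.2 ⟨⟨0, hn⟩, Finset.mem_univ _⟩)

section SpeedupW12

variable {V : Type*} [MetricSpace V] {n : ℕ} {I : RepairInstance V n} {s : ℝ} {r : ℕ∞}
  {F : PathFinder V} {γ : ℝ} {Γ : ℕ → ℕ}

theorem trials_spec {c : ℝ × ℝ × ℕ × ℕ} (hc : c ∈ trials) :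
    (0 < c.1 ∧ ∃ z : ℤ, 6 / (2 * c.1) = z) ∧
      (1 ≤ c.2.2.1 ∧ c.2.2.1 ≤ 2) ∧ 1 ≤ c.2.2.2 ∧ c.2.2.2 ≤ 3 := by
  have h1 : (∃ z : ℤ, (6 : ℝ) / (2 * (1 / 2)) = z) := ⟨6, by norm_num⟩
  have h2 : (∃ z : ℤ, (6 : ℝ) / (2 * (3 / 4)) = z) := ⟨4, by norm_num⟩
  have h3 : (∃ z : ℤ, (6 : ℝ) / (2 * 1) = z) := ⟨3, by norm_num⟩
  simp only [trials, List.mem_append, List.mem_flatMap, List.mem_map,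
    List.mem_cons, List.not_mem_nil, or_false] at hc
  rcases hc with (⟨i, -, j, hj, k, hk, rfl⟩ | ⟨i, -, j, hj, rfl⟩) | ⟨i, -, rfl⟩
  · exact ⟨⟨by norm_num, h1⟩, by rcases hj with rfl | rfl <;> simp,
      by rcases hk with rfl | rfl | rfl <;> simp⟩
  · exact ⟨⟨by norm_num, h2⟩, by rcases hj with rfl | rfl <;> simp, by simp⟩
  · exact ⟨⟨by norm_num, h3⟩, by simp, by simp⟩

theorem mem_trials_three_quarters (q : Fin 3) (j : Fin 2) :
    ((3 / 4 : ℝ), ((q : ℕ) : ℝ) / 4, (j : ℕ) + 1, 1) ∈ trials := by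
  refine List.mem_append_left _ (List.mem_append_right _ ?_)
  rw [List.mem_flatMap]
  refine ⟨(q : ℕ), List.mem_flatMap.2 ⟨q, List.mem_range.2 q.2, by simp⟩,
    List.mem_map.2 ⟨(j : ℕ) + 1, ?_, rfl⟩⟩
  fin_cases j <;> simp

/-- The work of SPEEDUPW12 for one trial. -/
def trialStep (F : PathFinder V) (I : RepairInstance V n) (s : ℝ) (r : ℕ∞)
    (best : ℕ × List (Fin n × ℝ)) (c : ℝ × ℝ × ℕ × ℕ) : Timed (ℕ × List (Fin n × ℝ)) := do
  let R ← speedup F I s r c.1 c.2.1 c.2.2.1 c.2.2.2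
  better best R

theorem speedupW12_eq (F : PathFinder V) (I : RepairInstance V n) (s : ℝ) (r : ℕ∞) :
    speedupW12 F I s r = (do
      let best ← Timed.loop (trialStep F I s r) (0, []) trials
      pure best.2) := rfl

theorem isRunWithProfit_speedupW12 (hF : F.IsApprox γ) (hs : 0 < s) :
    I.IsRunWithProfit s (Timed.loop (trialStep F I s r) (0, []) trials).val := by
  refine Timed.loop_invariant (p := I.IsRunWithProfit s) isRunWithProfit_nil fun B c hc hB => ?_
  obtain ⟨⟨h1, -⟩, h2, h3⟩ := trials_spec hc
  exact isRunWithProfit_better hB (isRunWithProfit_speedup hF hs h1 h2 h3)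

theorem speedup_le_speedupW12 (hF : F.IsApprox γ) (hs : 0 < s) {c : ℝ × ℝ × ℕ × ℕ}
    (hc : c ∈ trials) : (speedup F I s r c.1 c.2.1 c.2.2.1 c.2.2.2).val.1 ≤
      (speedupW12 F I s r).val.length := by
  rw [speedupW12_eq, Timed.val_bind, Timed.val_pure, (isRunWithProfit_speedupW12 hF hs).2]
  exact Timed.loop_establishes (p := fun _ => True) (q := fun B : ℕ × List (Fin n × ℝ) => _ ≤ B.1)
    hc trivial (fun _ _ _ _ => trivial) (fun B _ => le_better_right _ _)
    fun B c _ hB => hB.trans (le_better_left _ _)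

/-- A path through a single request already forces `1 ≤ γ * k` for some natural number `k`. -/
theorem PathFinder.IsApprox.nonneg (hF : F.IsApprox γ) (hn : 0 < n) (I : RepairInstance V n) :
    0 ≤ γ := by
  by_contra hγ
  let p : Fin n := ⟨0, hn⟩
  have h := ((hF n I.loc [p] (List.nodup_singleton p) p (by simp) p (by simp)).2 [p]
    ⟨List.nodup_singleton p, by simp, rfl, rfl⟩).2.2
  have h2 : γ * ((F n I.loc [p]).val p p [p].length).length ≤ 0 :=
    mul_nonpos_of_nonpos_of_nonneg (not_le.1 hγ).le (Nat.cast_nonneg _)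
  simp only [List.length_singleton, Nat.cast_one] at h h2
  linarith

theorem steps_speedupW12_le (hF : F.IsApprox γ) (hΓ : F.RunsIn Γ) (h4 : ∀ n, n ^ 4 ≤ Γ n)
    (hadd : ∀ a b, Γ a + Γ b ≤ Γ (a + b)) (hn : 0 < n) (hs : 0 < s) (hr : r ≠ 0) :
    ((speedupW12 F I s r).steps : ℕ∞) ≤
      ((10000 : ℕ) : ℕ∞) * min r (I.numPeriodSets (1 / 2) : ℕ∞) * (Γ n : ℕ∞) := by
  obtain ⟨M, hM⟩ : ∃ M : ℕ, min r (I.numPeriodSets (1 / 2) : ℕ∞) = M :=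
    ⟨_, (ENat.natCast_toNat (ne_top_of_le_ne_top (ENat.natCast_ne_top _) (min_le_right _ _))).symm⟩
  have hM1 : 1 ≤ M := by
    have : (1 : ℕ∞) ≤ M := by
      rw [← hM]
      refine le_min (Order.one_le_iff_pos.2 (pos_iff_ne_zero.2 hr)) ?_
      exact_mod_cast numPeriodSets_pos hn I (1 / 2)
    exact_mod_cast this
  rw [hM]
  have e4 := h4 n
  have e1 : 1 ≤ n ^ 4 := Nat.one_le_pow _ _ hn
  have e2 : n ≤ n ^ 4 := Nat.le_self_pow (by norm_num) n
  have e3 : n * n ≤ n ^ 4 := by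
    calc n * n = n ^ 2 := by ring
      _ ≤ n ^ 4 := Nat.pow_le_pow_right hn (by norm_num)
  have hΓM : Γ n ≤ M * Γ n := Nat.le_mul_of_pos_left _ hM1
  have hbody : ∀ (B : ℕ × List (Fin n × ℝ)), ∀ c ∈ trials,
      (trialStep F I s r B c).steps ≤ 400 * (M * Γ n) := by
    intro B c hc
    obtain ⟨⟨h1, z, hz⟩, h2, h3⟩ := trials_spec hc
    have hlen : (speedupOffsets I r c.1 c.2.1).length ≤ 6 * M := by
      have h5 := length_speedupOffsets_le I r c.1 c.2.1
      have h6 := length_criticalOffsets_le_numPeriodSets (τ₀ := c.2.1) I h1 hz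
      -- There are at most `r` offsets in either case. If the minimum is the number of period sets,
      -- the critical offsets bound them, up to the factor `6` for passing from residues modulo `1 /
      -- 2` to residues modulo the period length.
      rcases min_choice r (I.numPeriodSets (1 / 2) : ℕ∞) with h7 | h7
      · have h8 : (speedupOffsets I r c.1 c.2.1).length ≤ M :=
          Nat.cast_le.1 ((h5.trans (min_le_left _ _)).trans_eq (h7.symm.trans hM))
        omega
      · have h8 : (speedupOffsets I r c.1 c.2.1).length ≤ (criticalOffsets I c.1 c.2.1).length := by
          exact_mod_cast h5.trans (min_le_right _ _)
        have h9 : M = I.numPeriodSets (1 / 2) := by exact_mod_cast hM.symm.trans h7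
        omega
    have h5 := steps_speedup_le (F := F) (I := I) (s := s) (r := r)
      (steps_speedupStep_le hF hΓ h4 hadd hn hs h1 h2 h3 (τ₀ := c.2.1) (I := I))
    have h6 := Nat.mul_le_mul_right (1 + (n + 2 + 60 * Γ n)) hlen
    have h7 : 1 + (n + 2 + 60 * Γ n) ≤ 64 * Γ n := by omega
    have h8 := Nat.mul_le_mul_left (6 * M) h7
    have h9 : 6 * M * (64 * Γ n) = 384 * (M * Γ n) := by ring
    rw [trialStep, Timed.steps_bind]
    change _ + 1 ≤ _
    omega
  have h5 := Timed.loop_steps_le hbody (0, [])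
  have h6 : trials.length = 22 := rfl
  rw [h6] at h5
  have h7 : (speedupW12 F I s r).steps ≤ 10000 * M * Γ n := by
    rw [speedupW12_eq, Timed.steps_bind, Timed.steps_pure, mul_assoc]
    omega
  exact_mod_cast h7

/-- The stop `z` is serviced by the fast repairman when the periods have length `3 / 4`. -/
def IsCovered (I : RepairInstance V n) (s τ x : ℝ) (j : ℕ) (z : Fin n × ℝ) : Prop :=
  ∃ i, trimIndex (3 / 4) τ j 1 (I.start z.1) (I.finish z.1) = some i ∧
    IsRaced s (3 / 4) τ x i z.2

open Classical in
/-- In the trials with periods of length `3 / 4`, the repairman algorithm finds a profit in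
proportion to what a fast repairman covers. -/
theorem countP_isCovered_le (hF : F.IsApprox γ) (hn : 0 < n) (hs : 1 ≤ s)
    {R : List (Fin n × ℝ)} (hR : I.IsServiceRun 1 R) (q : Fin 3) (j : Fin 2) (x : ℝ) {δ : ℝ}
    (hδ : δ ∈ speedupOffsets I r (3 / 4) (((q : ℕ) : ℝ) / 4)) :
    ((R.countP fun z => IsCovered I s (((q : ℕ) : ℝ) / 4 + δ) x ((j : ℕ) + 1) z : ℕ) : ℝ) ≤
      γ * (speedupW12 F I s r).val.length := by
  have hγ := hF.nonneg hn I
  have hs0 : 0 < s := by linarith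
  have hj : 1 ≤ (j : ℕ) + 1 ∧ (j : ℕ) + 1 ≤ 2 := by omega
  have hα : (0 : ℝ) < 3 / 4 := by norm_num
  have h1 := countP_raced_le_repairman hF hγ hs hα
    (trimIndex_per (I := I) hα hj ⟨le_rfl, by norm_num⟩ (((q : ℕ) : ℝ) / 4 + δ)) hR x
    (IsCovered I s (((q : ℕ) : ℝ) / 4 + δ) x ((j : ℕ) + 1)) fun z hz => hz
  have h2 := repairman_le_speedup (F := F) (s := s) (j := (j : ℕ) + 1) (k := 1) hδ
  have h3 := speedup_le_speedupW12 (I := I) (r := r) hF hs0 (mem_trials_three_quarters q j)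
  dsimp only at h3
  have h4 := h2.trans h3
  refine h1.trans (mul_le_mul_of_nonneg_left (Nat.cast_le.2 h4) hγ)

/-- A single trial, with starting point `0` and `j = 1`, already covers every stop. -/
theorem length_le_of_speed_ge (hF : F.IsApprox γ) (hn : 0 < n) (hr : r ≠ 0) (hs : 14 / 3 ≤ s)
    (hlen : ∀ p, 3 / 2 < I.finish p - I.start p ∧ I.finish p - I.start p ≤ 2)
    {R : List (Fin n × ℝ)} (hR : I.IsServiceRun 1 R) :
    (R.length : ℝ) ≤ γ * (speedupW12 F I s r).val.length := by
  classical
  obtain ⟨δ, hδ, -, -⟩ := exists_speedupOffset (I := I) (r := r)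
    (τ₀ := (((0 : Fin 3) : ℕ) : ℝ) / 4) hn hr (by norm_num : (0 : ℝ) < 3 / 4)
  set τ : ℝ := (((0 : Fin 3) : ℕ) : ℝ) / 4 + δ with hτ
  obtain ⟨ε, hε, hεp⟩ := exists_pos_add_le I.start fun p => firstStart τ (I.start p)
  refine le_trans ?_ (countP_isCovered_le hF hn (by linarith) hR 0 0 (3 / 4 + ε) hδ)
  rw [Nat.cast_le]
  refine (List.countP_eq_length.2 fun z hz => ?_).ge
  have hz' := hR.2.1 z hz
  rw [decide_eq_true_eq]
  exact isRaced_of_le hs hε (hlen z.1).1 (hlen z.1).2 (hεp ε le_rfl z.1 (lt_firstStart _ _))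
    hz'.1 hz'.2

/-- Averaging over the six trials with periods of length `3 / 4`: every stop is covered at least
four times, twice for one starting point and at least once for each of the other two. -/
theorem length_le_of_speed_le (hF : F.IsApprox γ) (hn : 0 < n) (hr : r ≠ 0) (hs : 4 ≤ s)
    (hlen : ∀ p, 3 / 2 < I.finish p - I.start p ∧ I.finish p - I.start p ≤ 2)
    {R : List (Fin n × ℝ)} (hR : I.IsServiceRun 1 R) :
    4 * (R.length : ℝ) ≤ 6 * (γ * (speedupW12 F I s r).val.length) := by
  classical
  have hδ := fun q : Fin 3 => exists_speedupOffset (I := I) (r := r)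
    (τ₀ := ((q : ℕ) : ℝ) / 4) hn hr (by norm_num : (0 : ℝ) < 3 / 4)
  choose δ hδ hδ0 hδp using hδ
  have hε := fun q : Fin 3 => exists_pos_add_le I.finish fun p =>
    firstStart (((q : ℕ) : ℝ) / 4 + δ q) (I.start p) + 3 / 2
  choose ε hε hεp using hε
  let e : Fin 3 → ℝ := fun q => min (ε q) (1 / 4)
  have he : ∀ q, 0 < e q := fun q => lt_min (hε q) (by norm_num)
  let p : Fin 3 × Fin 2 → Fin n × ℝ → Prop := fun k z =>
    IsCovered I s (((k.1 : ℕ) : ℝ) / 4 + δ k.1) (3 / 4 + e k.1) ((k.2 : ℕ) + 1) z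
  have hcount : 4 * R.length ≤ ∑ k, R.countP fun z => p k z := by
    refine mul_length_le_sum_countP p 4 R fun z hz => ?_
    obtain ⟨hz1, hz2⟩ := hR.2.1 z hz
    have h1 : ∀ q, p (q, 0) z ∨ p (q, 1) z := fun q =>
      isRaced_or_isRaced hs (he q) (min_le_right _ _) (hlen z.1).1 (hlen z.1).2
        (hεp q (e q) (min_le_left _ _) z.1) hz1 hz2
    obtain ⟨q, hq⟩ := exists_half_lt_floor (I.start z.1)
    have hfirst : I.finish z.1 < firstStart (((q : ℕ) : ℝ) / 4 + δ q) (I.start z.1) + 3 / 2 := by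
      -- Moving by `δ q` keeps the index of the first filled period, and since `0 ≤ δ q` its
      -- beginning only moves later. It stays more than `1 / 2` after the window start, so the
      -- window ends less than `3 / 2` after it.
      rw [firstStart, hδp]
      linarith [hδ0 q, (hlen z.1).2]
    have h2 : ∀ j, p (q, j) z := fun j =>
      isRaced_of_lt_firstStart hs (he q) (hlen z.1).1 (hlen z.1).2 hfirst
        (hεp q (e q) (min_le_left _ _) z.1 hfirst) hz1 hz2 _
    have h3 : ∀ q, 1 ≤ (if p (q, 0) z then 1 else 0) + if p (q, 1) z then 1 else 0 := by
      intro q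
      rcases h1 q with h | h
      · rw [if_pos h]; omega
      · rw [if_pos h]; omega
    have h4 : (if p (q, 0) z then 1 else 0) + (if p (q, 1) z then 1 else 0) = 2 := by
      rw [if_pos (h2 0), if_pos (h2 1)]
    rw [Fintype.sum_prod_type]
    simp only [Fin.sum_univ_two, Fin.sum_univ_three]
    have h5 := h3 0
    have h6 := h3 1
    have h7 := h3 2
    obtain rfl | rfl | rfl : q = 0 ∨ q = 1 ∨ q = 2 := by omega
    all_goals omega
  have hsum : ((∑ k, R.countP fun z => p k z : ℕ) : ℝ) ≤
      ∑ _k : Fin 3 × Fin 2, γ * (speedupW12 F I s r).val.length := by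
    push_cast
    exact Finset.sum_le_sum fun k _ =>
      countP_isCovered_le hF hn (by linarith) hR k.1 k.2 _ (hδ k.1)
  have hcard : Fintype.card (Fin 3 × Fin 2) = 6 := rfl
  rw [Finset.sum_const, Finset.card_univ, hcard, nsmul_eq_mul] at hsum
  have h : ((4 * R.length : ℕ) : ℝ) ≤ _ := (Nat.cast_le.2 hcount).trans hsum
  push_cast at h
  exact h

end SpeedupW12

end

theorem mainTheorem10 :
    ∃ C : ℕ, ∀ (V : Type*) [MetricSpace V] (F : PathFinder V) (γ : ℝ) (Γ : ℕ → ℕ),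
      F.IsApprox γ → F.RunsIn Γ →
      (∀ n, n ^ 4 ≤ Γ n) → (∀ a b, Γ a + Γ b ≤ Γ (a + b)) →
      ∀ (n : ℕ) (I : RepairInstance V n), 0 < n →
      (∀ p, 1 ≤ I.finish p - I.start p ∧ I.finish p - I.start p ≤ 2) →
      ∀ τ : ℝ, (∀ p, InW 3 (1 / 2) τ (I.start p) (I.finish p)) →
      ∀ (s : ℝ) (r : ℕ∞), 4 ≤ s → s ≤ 6 →
      (r = ⊤ ∨ ∃ a b : ℕ, 0 < b ∧ s = (a : ℝ) / (b : ℝ) ∧ r = (b : ℕ∞)) →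
      I.IsServiceRun s (speedupW12 F I s r).val ∧
      (∀ R, I.IsServiceRun 1 R →
        (R.length : ℝ) ≤ 4 * γ / (s - 2) * ((speedupW12 F I s r).val.length : ℝ)) ∧
      ((speedupW12 F I s r).steps : ℕ∞) ≤
        (C : ℕ∞) * min r (I.numPeriodSets (1 / 2) : ℕ∞) * (Γ n : ℕ∞) := by
  refine ⟨10000, ?_⟩
  intro V _ F γ Γ hF hΓ h4 hadd n I hn hlen τ hW s r hs hs6 hr
  have hs0 : 0 < s := by linarith
  have hr0 : r ≠ 0 := by
    rcases hr with rfl | ⟨a, b, hb, -, rfl⟩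
    · exact ENat.top_ne_zero
    · exact_mod_cast hb.ne'
  have hlen' : ∀ p, 3 / 2 < I.finish p - I.start p ∧ I.finish p - I.start p ≤ 2 := fun p =>
    ⟨lt_sub_of_inW_three (hW p), (hlen p).2⟩
  refine ⟨(isRunWithProfit_speedupW12 hF hs0).1, fun R hR => ?_,
    steps_speedupW12_le hF hΓ h4 hadd hn hs0 hr0⟩
  have hX : 0 ≤ γ * ((speedupW12 F I s r).val.length : ℝ) :=
    mul_nonneg (hF.nonneg hn I) (Nat.cast_nonneg _)
  rw [div_mul_eq_mul_div, le_div_iff₀ (by linarith), mul_assoc]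
  have hR0 : (0 : ℝ) ≤ R.length := Nat.cast_nonneg _
  -- At `s = 14 / 3` the claimed factor `4 / (s - 2)` equals `3 / 2`. Below, it is at least the
  -- factor `6 / 4` from averaging; above, it is still at least `1` because `s ≤ 6`.
  rcases le_total (14 / 3) s with hs' | hs'
  · have h := length_le_of_speed_ge hF hn hr0 hs' hlen' hR
    nlinarith
  · have h := length_le_of_speed_le hF hn hr0 hs hlen' hR
    nlinarith
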